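/- Let $\kappa$ be an uncountable regular cardinal with $2^{<\kappa}=\kappa$. In a forcing, $p\le q$ means that $p$ is stronger than $q$. A forcing is *$\kappa$-closed* if every decreasing sequence of fewer than $\kappa$ conditions has a lower bound, and *$\kappa$-directed closed* if every set of fewer than $\kappa$ pairwise compatible conditions has a lower bound. * $\mathbb S$ consists of the sequences $\langle C_\alpha\mid\alpha\le\gamma\rangle$, $\gamma<\kappa$, with $C_\alpha\subseteq\alpha$ club in $\alpha$, $C_{\beta+1}=\{\beta\}$, and $C_\alpha\cap\beta=C_\beta$ for every accumulation point $\beta$ of $C_\alpha$; it is ordered by end-extension. Let $\langle C_\delta\mid\delta<\kappa\rangle$ be the generic sequence added by $\mathbb S$. * In any extension of $W^{\mathbb S}$ ($W$ the ground model), $\mathbb T=\{C_\delta\mid\delta<\kappa\text{ limit or }0\}$, ordered by end-extension; its maximal condition is $C_0=\emptyset$. * $\mathbb S*\mathbb R_\alpha$ $(\alpha\le\kappa^+)$ is the iteration with supports of size $<\kappa$ whose first step is $\mathbb S$ and whose step $\beta<\alpha$ is the forcing $\dot{\mathbb Q}_\beta$ of closed bounded subsets of $\kappa$ disjoint from $\dot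 A_\beta$, ordered by end-extension. Here a bookkeeping function assigns to every $\beta<\kappa^+$ an $\mathbb S*\mathbb R_{\beta'}$-name $\dot B_\beta$ for a subset of $\kappa$, for some $\beta'\le\beta$; $\dot A_\beta=\dot B_\beta$ if $\mathbb S*\mathbb R_\beta*\mathbb T$ forces (by its maximal condition) that $\dot B_\beta$ is nonstationary in $\kappa$, and $\dot A_\beta=\emptyset$ otherwise. Put $\mathbb R=\mathbb R_{\kappa^+}$. Then, for every bookkeeping function (in particular for one that handles every name for a subset of $\kappa$): 1. for every $\alpha\le\kappa^+$, $\mathbb S*\mathbb R_\alpha*\mathbb T$ has a dense subset which is $\kappa$-closed and indeed $\kappa$-directed closed; 2. $\mathbb S*\mathbb R*\mathbb T$ is forcing equivalent (has isomorphic Boolean completion) to a $\kappa$-directed closed forcing; 3. in $W^{\mathbb S}$, $\mathbb R$ is $\kappa$-distributive: it adds no new sequences of ordinals of length less than $\kappa$; 4. in $W^{\mathbb S}$, $\mathbb R$ does not collapse cardinals: every cardinal of $W^{\mathbb S}$ is still a cardinal in $W^{\mathbb S*\mathbb R}$. -/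

import Mathlib

open Cardinal Ordinal Set

universe u

namespace SquareThread

/-! ## Posets: closure, density, equivalence of forcings (`p ≤ q` means `p` is stronger) -/

/-- Every decreasing sequence of fewer than `κ` conditions has a lower bound. -/
def IsKClosed (κ : Cardinal.{u}) (P : Type u) [Preorder P] : Prop :=
  ∀ η : Ordinal.{u}, η < κ.ord → ∀ p : η.ToType → P, Antitone p → ∃ q, ∀ i, q ≤ p i

def Compatible {P : Type u} [LE P] (p q : P) : Prop := ∃ r, r ≤ p ∧ r ≤ q

/-- Every set of fewer than `κ` pairwise compatible conditions has a lower bound. -/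
def IsKDirectedClosed (κ : Cardinal.{u}) (P : Type u) [Preorder P] : Prop :=
  ∀ X : Set P, #X < κ → (∀ p ∈ X, ∀ q ∈ X, Compatible p q) → ∃ q, ∀ p ∈ X, q ≤ p

def IsDenseIn {P : Type u} [LE P] (D : Set P) : Prop := ∀ p, ∃ d ∈ D, d ≤ p

/-- The regular open algebra of a forcing: the regular elements of the Heyting algebra of
downward closed sets of conditions. -/
abbrev RO (P : Type u) [Preorder P] : Type u := Heyting.Regular (LowerSet P)

/-- Forcing equivalence: isomorphic Boolean completions. -/
def ForcingEquiv (P Q : Type u) [Preorder P] [Preorder Q] : Prop :=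
  Nonempty (RO P ≃o RO Q)

/-! ## Names for subsets of ground model sets, and the forcing relation -/

/-- A `P`-name for a subset of the ground model set `X`, i.e. a subset of `X × P`;
`p ∈ A x` says that the pair `(x, p)` belongs to the name. -/
abbrev Name (P X : Type u) : Type u := X → Set P

/-- A statement of the forcing language, given by the conditions which force it. -/
abbrev Stmt (P : Type u) : Type u := P → Prop

namespace Stmt

variable {P : Type u} [LE P] {X : Type u}

/-- `x ∈ A` -/
def mem (x : X) (A : Name P X) : Stmt P :=
  fun p ↦ ∀ q ≤ p, ∃ r ≤ q, ∃ a ∈ A x, r ≤ a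

def neg (φ : Stmt P) : Stmt P := fun p ↦ ∀ q ≤ p, ¬ φ q

def and (φ ψ : Stmt P) : Stmt P := fun p ↦ φ p ∧ ψ p

def imp (φ ψ : Stmt P) : Stmt P := fun p ↦ ∀ q ≤ p, φ q → ψ q

/-- Universal quantification, over elements of a ground model set or over names. -/
def all {I : Type*} (φ : I → Stmt P) : Stmt P := fun p ↦ ∀ i, φ i p

/-- Existential quantification, over elements of a ground model set or over names. -/
def ex {I : Type*} (φ : I → Stmt P) : Stmt P := fun p ↦ ∀ q ≤ p, ∃ r ≤ q, ∃ i, φ i r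

/-- A statement about the ground model. -/
def ground (a : Prop) : Stmt P := fun _ ↦ a

/-- `A = B` -/
def eq (A B : Name P X) : Stmt P :=
  all fun x ↦ and (imp (mem x A) (mem x B)) (imp (mem x B) (mem x A))

/-- `A` is (the graph of) a function from `X` to `Y`. -/
def isFunction {Y : Type u} (A : Name P (X × Y)) : Stmt P :=
  and (all fun x ↦ ex fun y ↦ mem (x, y) A)
    (all fun x ↦ all fun y ↦ all fun y' ↦
      imp (and (mem (x, y) A) (mem (x, y') A)) (ground (y = y')))

/-- Every element of `Y` is a value of `A`. -/
def isOnto {Y : Type u} (A : Name P (X × Y)) : Stmt P :=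
  all fun y ↦ ex fun x ↦ mem (x, y) A

/-- The ordinal `θ` is a cardinal: there is no function from a smaller ordinal onto it. -/
def isCardinal (θ : Ordinal.{u}) : Stmt P :=
  all fun η : Iio θ ↦ neg (ex fun F : Name P ((η : Ordinal.{u}).ToType × θ.ToType) ↦
    and (isFunction F) (isOnto F))

section LinearOrder

variable [LinearOrder X]

/-- `β` is an accumulation point of `A`. -/
def isAcc (A : Name P X) (β : X) : Stmt P :=
  and (ex fun y : Iio β ↦ mem (y : X) A)
    (all fun x : Iio β ↦ ex fun y : Ioo (x : X) β ↦ mem (y : X) A)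

/-- `A` is closed in `X`. -/
def isClosed (A : Name P X) : Stmt P := all fun β ↦ imp (isAcc A β) (mem β A)

def isBounded (A : Name P X) : Stmt P :=
  ex fun δ : X ↦ all fun x ↦ imp (mem x A) (ground (x < δ))

def isUnbounded (A : Name P X) : Stmt P :=
  all fun x : X ↦ ex fun y : Ici x ↦ mem (y : X) A

def isDisjoint (A B : Name P X) : Stmt P := all fun x ↦ neg (and (mem x A) (mem x B))

/-- Some club of `X` is disjoint from `A`. -/
def isNonstationary (A : Name P X) : Stmt P :=
  ex fun E : Name P X ↦ and (and (isClosed E) (isUnbounded E)) (isDisjoint E A)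

/-- `A` end-extends `B`: `B ⊆ A`, and every element of `A` below an element of `B` is in `B`. -/
def endExtends (A B : Name P X) : Stmt P :=
  and (all fun x ↦ imp (mem x B) (mem x A))
    (all fun y ↦ all fun x : Iic y ↦ imp (and (mem y B) (mem (x : X) A)) (mem (x : X) B))

/-- `c` is a condition of the forcing shooting a club disjoint from `A`. -/
def isClubShooting (A c : Name P X) : Stmt P :=
  and (and (isClosed c) (isBounded c)) (isDisjoint c A)

end LinearOrder

end Stmt

theorem Stmt.endExtends_refl {P X : Type u} [LE P] [LinearOrder X] (A : Name P X) (p : P) :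
    Stmt.endExtends A A p :=
  ⟨fun _ _ _ h ↦ h, fun _ _ _ _ h ↦ h.2⟩

theorem Stmt.endExtends_trans {P X : Type u} [LE P] [LinearOrder X]
    (htrans : ∀ p q r : P, p ≤ q → q ≤ r → p ≤ r) {A B C : Name P X} {p q : P} (hpq : p ≤ q)
    (hAB : Stmt.endExtends A B p) (hBC : Stmt.endExtends B C q) : Stmt.endExtends A C p := by
  refine ⟨fun x r hr h ↦ hAB.1 x r hr (hBC.1 x r (htrans _ _ _ hr hpq) h), fun y x r hr h ↦ ?_⟩
  have hrq := htrans _ _ _ hr hpq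
  exact hBC.2 y x r hrq ⟨h.1, hAB.2 y x r hr ⟨hBC.1 y r hrq h.1, h.2⟩⟩

/-! ## Forcing over an intermediate model

For a projection `π : Q → P`, a `P`-name is also a `Q`-name, and the generic extension by `Q` is an
extension of the one by `P`. -/

def Name.lift {P Q X : Type u} (π : Q → P) (A : Name P X) : Name Q X := fun x ↦ π ⁻¹' A x

/-- Over the extension by `P`, the quotient forcing `Q / P` adds no sequences of ordinals of length
less than `κ`. -/
def IsKDistributiveOver (κ : Cardinal.{u}) {P Q : Type u} [Preorder P] [Preorder Q]
    (π : Q → P) : Prop :=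
  ∀ η : Ordinal.{u}, η < κ.ord → ∀ (θ : Ordinal.{u}) (F : Name Q (η.ToType × θ.ToType)) (q : Q),
    Stmt.isFunction F q →
      ∃ r ≤ q, ∃ G : Name P (η.ToType × θ.ToType), Stmt.eq F (G.lift π) r

/-- Over the extension by `P`, the quotient forcing `Q / P` does not collapse cardinals. -/
def PreservesCardinalsOver {P Q : Type u} [Preorder P] [Preorder Q] (π : Q → P) : Prop :=
  ∀ (θ : Ordinal.{u}) (q : Q), Stmt.isCardinal θ (π q) → Stmt.isCardinal θ q

/-! ## The forcing adding a square sequence -/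

/-- The ordinals below `κ`. -/
abbrev K (κ : Cardinal.{u}) : Type u := κ.ord.ToType

/-- The ordinals below `κ⁺`. -/
abbrev L (κ : Cardinal.{u}) : Type u := (Order.succ κ).ord.ToType

/-- `β` is an accumulation point of the set `C`. -/
def IsAcc {X : Type u} [LinearOrder X] (C : Set X) (β : X) : Prop :=
  (∃ y ∈ C, y < β) ∧ ∀ x < β, ∃ y ∈ C, x < y ∧ y < β

/-- Conditions: coherent sequences `⟨C α | α ≤ top⟩` with `C α` a club of `α`. The entries
above `top` carry no information and are set to `∅`. -/
structure SCond (κ : Cardinal.{u}) : Type u where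
  top : K κ
  C : K κ → Set (K κ)
  subset : ∀ α ≤ top, C α ⊆ Iio α
  isClub : ∀ α ≤ top, IsClub ((↑) ⁻¹' C α : Set (Iio α))
  succ : ∀ α ≤ top, ∀ β, β ⋖ α → C α = {β}
  coherent : ∀ α ≤ top, ∀ β, IsAcc (C α) β → C α ∩ Iio β = C β
  eq_empty : ∀ α, top < α → C α = ∅

instance (κ : Cardinal.{u}) : Preorder (SCond κ) where
  le s t := t.top ≤ s.top ∧ ∀ α ≤ t.top, s.C α = t.C α
  le_refl s := ⟨le_rfl, fun _ _ ↦ rfl⟩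
  le_trans s t v h h' := ⟨h'.1.trans h.1, fun α hα ↦ (h.2 α (hα.trans h'.1)).trans (h'.2 α hα)⟩

/-! ## The threading forcing, over an extension of the extension by `SCond κ` -/

section Thread

variable {κ : Cardinal.{u}} {P : Type u} [LE P]

/-- The name of the `δ`-th entry of the generic square sequence. -/
def genericSquare (π : P → SCond κ) (δ : K κ) : Name P (K κ) :=
  fun ξ ↦ {p | δ ≤ (π p).top ∧ ξ ∈ (π p).C δ}

/-- `t` is a condition of the threading forcing: it is the `δ`-th entry of the generic square
sequence, for some limit ordinal `δ < κ` (`δ = 0` is allowed and gives the maximal condition). -/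
def isThreadCond (π : P → SCond κ) (t : Name P (K κ)) : Stmt P :=
  Stmt.ex fun δ : {δ : K κ // Order.IsSuccPrelimit δ} ↦ Stmt.eq t (genericSquare π δ)

/-- The two-step iteration `P * 𝕋`, where `π : P → 𝕊` induces the generic square sequence. -/
structure WithThread (π : P → SCond κ) : Type u where
  fst : P
  thread : Name P (K κ)
  forces : isThreadCond π thread fst

instance (π : P → SCond κ) : LE (WithThread π) where
  le p q := p.fst ≤ q.fst ∧ Stmt.endExtends p.thread q.thread p.fst

instance {κ : Cardinal.{u}} {P : Type u} [Preorder P] (π : P → SCond κ) :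
    Preorder (WithThread π) where
  le_refl p := ⟨le_rfl, Stmt.endExtends_refl _ _⟩
  le_trans _ _ _ h h' := ⟨h.1.trans h'.1,
    Stmt.endExtends_trans (fun _ _ _ ↦ le_trans) h.1 h.2 h'.2⟩

open Classical in
/-- The name of the set to be killed: the candidate `B`, if `P * 𝕋` forces that `B` is
nonstationary in `κ`, and the empty set otherwise. -/
noncomputable def killed (π : P → SCond κ) (B : Name P (K κ)) : Name P (K κ) :=
  if ∀ p : WithThread π, Stmt.isNonstationary (B.lift WithThread.fst) p then B else fun _ ↦ ∅

end Thread

/-! ## The iteration `𝕊 * ℝ_α`, for `α ≤ κ⁺` (elements of `WithTop (L κ)`) -/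

instance (κ : Cardinal.{u}) : WellFoundedRelation (WithTop (L κ)) := ⟨(· < ·), wellFounded_lt⟩

/-- Raw conditions of length `α`: an element of `𝕊`, and for each `β < α` a subset of
`κ × (raw conditions of length β)`. -/
def Raw (κ : Cardinal.{u}) (α : WithTop (L κ)) : Type u :=
  SCond κ × (∀ β : L κ, (β : WithTop (L κ)) < α → K κ → Set (Raw κ β))
termination_by α
decreasing_by assumption

namespace Raw

variable {κ : Cardinal.{u}} {α β γ : WithTop (L κ)}

noncomputable def equiv (α : WithTop (L κ)) :
    Raw κ α ≃ SCond κ × (∀ β : L κ, (β : WithTop (L κ)) < α → K κ → Set (Raw κ β)) :=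
  Equiv.cast (by rw [Raw])

/-- The first coordinate, in `𝕊`. -/
noncomputable def base (p : Raw κ α) : SCond κ := (equiv α p).1

/-- The coordinate `p(β)`, a name for a subset of `κ`. -/
noncomputable def coord (p : Raw κ α) (β : L κ) (h : (β : WithTop (L κ)) < α) :
    Name (Raw κ β) (K κ) := (equiv α p).2 β h

/-- The restriction of `p` to a smaller length. -/
noncomputable def restrict (p : Raw κ α) (h : β ≤ α) : Raw κ β :=
  (equiv β).symm (p.base, fun γ hγ ↦ p.coord γ (hγ.trans_le h))

@[simp] theorem base_restrict (p : Raw κ α) (h : β ≤ α) : (p.restrict h).base = p.base := by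
  simp [restrict, base]

@[simp] theorem coord_restrict (p : Raw κ α) (h : β ≤ α) (γ : L κ)
    (hγ : (γ : WithTop (L κ)) < β) :
    (p.restrict h).coord γ hγ = p.coord γ (hγ.trans_le h) := by
  simp [restrict, coord]

@[simp] theorem restrict_restrict (p : Raw κ α) (h : β ≤ α) (h' : γ ≤ β) :
    (p.restrict h).restrict h' = p.restrict (h'.trans h) := by
  simp [restrict, base, coord]

end Raw

/-- The poset at some stage: which raw conditions are conditions, and their order. -/
structure PosetData (X : Type u) : Type u where
  valid : Set X
  le : X → X → Prop

def PosetData.Carrier {X : Type u} (D : PosetData X) : Type u := {x // x ∈ D.valid}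

instance {X : Type u} (D : PosetData X) : LE D.Carrier where
  le x y := D.le x.1 y.1

/-- The bookkeeping: `f α = (β, γ)` says that stage `α` handles the `γ`-th name of stage `β ≤ α`,
and `name β γ` is the `γ`-th name of stage `β`. The bookkeepings for which `f` is onto and
`name β` lists all names of stage `β` up to forced equality are a special case. -/
structure Bookkeeping (κ : Cardinal.{u}) : Type u where
  f : L κ → L κ × L κ
  f_le : ∀ α, (f α).1 ≤ α
  name : ∀ β : L κ, L κ → Name (Raw κ β) (K κ)

variable {κ : Cardinal.{u}}

/-- The candidate handled at stage `α`, as a name of stage `α`. -/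
noncomputable def Bookkeeping.candidate (b : Bookkeeping κ) (α : L κ) : Name (Raw κ α) (K κ) :=
  (b.name (b.f α).1 (b.f α).2).lift fun p ↦ p.restrict (WithTop.coe_le_coe.2 (b.f_le α))

/-- The projection of the poset at some stage to `𝕊`. -/
noncomputable def PosetData.toS {α : WithTop (L κ)} {D : PosetData (Raw κ α)} (p : D.Carrier) :
    SCond κ := p.1.base

/-- The iteration `𝕊 * ℝ_α` with supports of size `< κ`. Raw conditions `p` are conditions if the
set of `β` such that `p(β)` is not the name `∅` of the maximal condition has size `< κ`, and if
each `p ↾ β` is a condition which forces that `p(β)` is a condition of the forcing which shoots a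
club disjoint from the set killed at stage `β`. The order is given by `p(𝕊) ≤ q(𝕊)` and
`p ↾ β ⊩ p(β) end-extends q(β)` for all `β < α`. -/
noncomputable def stage (b : Bookkeeping κ) (α : WithTop (L κ)) : PosetData (Raw κ α) :=
  { valid := {p | #{β : L κ // ∃ h : (β : WithTop (L κ)) < α, p.coord β h ≠ fun _ ↦ ∅} < κ ∧
    ∀ (β : L κ) (h : (β : WithTop (L κ)) < α),
      ∃ hp : p.restrict h.le ∈ (stage b β).valid,
        Stmt.isClubShooting (P := (stage b β).Carrier)
          (killed PosetData.toS ((b.candidate β).lift Subtype.val))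
          ((p.coord β h).lift Subtype.val) ⟨p.restrict h.le, hp⟩}
    le := fun p q ↦ p.base ≤ q.base ∧
    ∀ (β : L κ) (h : (β : WithTop (L κ)) < α) (hp : p.restrict h.le ∈ (stage b β).valid),
      Stmt.endExtends (P := (stage b β).Carrier)
        ((p.coord β h).lift Subtype.val) ((q.coord β h).lift Subtype.val) ⟨p.restrict h.le, hp⟩ }
termination_by α
decreasing_by all_goals assumption

/-- The forcing `𝕊 * ℝ_α`. -/
def SR (b : Bookkeeping κ) (α : WithTop (L κ)) : Type u := (stage b α).Carrier

theorem stage_le_iff (b : Bookkeeping κ) (α : WithTop (L κ)) (p q : Raw κ α) :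
    (stage b α).le p q ↔ p.base ≤ q.base ∧
      ∀ (β : L κ) (h : (β : WithTop (L κ)) < α) (hp : p.restrict h.le ∈ (stage b β).valid),
        Stmt.endExtends (P := (stage b β).Carrier)
          ((p.coord β h).lift Subtype.val) ((q.coord β h).lift Subtype.val)
          ⟨p.restrict h.le, hp⟩ := by
  rw [stage]

theorem mem_stage_valid_iff (b : Bookkeeping κ) (α : WithTop (L κ)) (p : Raw κ α) :
    p ∈ (stage b α).valid ↔
      #{β : L κ // ∃ h : (β : WithTop (L κ)) < α, p.coord β h ≠ fun _ ↦ ∅} < κ ∧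
      ∀ (β : L κ) (h : (β : WithTop (L κ)) < α),
        ∃ hp : p.restrict h.le ∈ (stage b β).valid,
          Stmt.isClubShooting (P := (stage b β).Carrier)
            (killed PosetData.toS ((b.candidate β).lift Subtype.val))
            ((p.coord β h).lift Subtype.val) ⟨p.restrict h.le, hp⟩ := by
  rw [stage]
  rfl

theorem stage_le_restrict (b : Bookkeeping κ) {α : WithTop (L κ)} {p q : Raw κ α}
    (h : (stage b α).le p q) {β : WithTop (L κ)} (hβ : β ≤ α) :
    (stage b β).le (p.restrict hβ) (q.restrict hβ) := by
  rw [stage_le_iff] at h ⊢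
  refine ⟨by simpa using h.1, fun γ hγ hp ↦ ?_⟩
  simp only [Raw.coord_restrict, Raw.restrict_restrict] at hp ⊢
  exact h.2 γ (hγ.trans_le hβ) hp

theorem stage_le_trans (b : Bookkeeping κ) (α : WithTop (L κ)) :
    ∀ p q r : (stage b α).Carrier, p ≤ q → q ≤ r → p ≤ r := by
  induction α using WellFoundedLT.induction with
  | ind α ih =>
    intro p q r hpq hqr
    have h := (stage_le_iff b α _ _).1 hpq
    have h' := (stage_le_iff b α _ _).1 hqr
    refine (stage_le_iff b α _ _).2 ⟨h.1.trans h'.1, fun β hβ hp ↦ ?_⟩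
    obtain ⟨hq, -⟩ := ((mem_stage_valid_iff b α q.1).1 q.2).2 β hβ
    exact Stmt.endExtends_trans (ih β hβ) (q := ⟨q.1.restrict hβ.le, hq⟩)
      (stage_le_restrict b hpq hβ.le) (h.2 β hβ hp) (h'.2 β hβ hq)

instance (b : Bookkeeping κ) (α : WithTop (L κ)) : Preorder (SR b α) where
  le p q := (stage b α).le p.1 q.1
  le_refl p := (stage_le_iff b α _ _).2 ⟨le_rfl, fun _ _ _ ↦ Stmt.endExtends_refl _ _⟩
  le_trans := stage_le_trans b α

/-- The projection of `𝕊 * ℝ_α` to `𝕊`. -/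
noncomputable def SR.toS {b : Bookkeeping κ} {α : WithTop (L κ)} : SR b α → SCond κ :=
  PosetData.toS

/-- The forcing `𝕊 * ℝ_α * 𝕋`. -/
abbrev SRT (b : Bookkeeping κ) (α : WithTop (L κ)) : Type u :=
  WithThread (SR.toS : SR b α → SCond κ)

end SquareThread

/-! The forcing `𝕊 * ℝ_α * 𝕋` is analysed through conditions all of whose data lie in the ground
model: a square condition `s` whose last entry serves as the thread, and for each `β` an actual set
`c β ⊆ κ`. For such a condition to be good, every nonempty `c β` must have a maximum which, with the
thread adjoined, is forced into one fixed club disjoint from the set killed at stage `β`. Such a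
club exists after forcing with `𝕋`, because only sets forced to be nonstationary are killed.

Good conditions have lower bounds. In a coherent family the last entries are initial segments of one
another, so their union is a legitimate entry at the supremum of the tops. On each coordinate one
takes the union and adds its supremum. That point is in the club or is a limit of points of the
club, so it belongs to the club and avoids the killed set. This is `exists_isGood_forall_le`, and
`isKDirectedClosed_goodSet` follows.

Good conditions are dense (`isDenseIn_goodSet`), by induction on `α`. The coordinates in the support
are treated in increasing order. At coordinate `β`, the closure and density already known for stage
`β` make that stage distributive, so the bounded name `p(β)` can be decided outright and capped by a
point of the club (`exists_isGood_endExtends_coord`).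

The rest follows from this dense set. Functions on sets of size `< κ` are decided by single
conditions. Coding good conditions by small sets and using `2^{<κ} = κ` gives the `κ⁺`-chain
condition. Together these turn any surjection onto an ordinal in the extension into one in the
ground model. -/

namespace SquareThread

/-! ## End-extension and accumulation points of sets in the ground model -/

section LinearOrder

variable {X : Type*} [LinearOrder X] {A B C : Set X}

/-- `A` end-extends `B`. -/
def EndExt (A B : Set X) : Prop := B ⊆ A ∧ ∀ y ∈ B, ∀ x ∈ A, x ≤ y → x ∈ B

theorem EndExt.refl (A : Set X) : EndExt A A := ⟨Subset.rfl, fun _ _ _ h _ ↦ h⟩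

theorem EndExt.trans (h : EndExt A B) (h' : EndExt B C) : EndExt A C :=
  ⟨h'.1.trans h.1, fun y hy x hx hxy ↦ h'.2 y hy x (h.2 y (h'.1 hy) x hx hxy) hxy⟩

theorem EndExt.empty (A : Set X) : EndExt A ∅ := ⟨empty_subset _, fun _ h ↦ h.elim⟩

/-- Two initial segments of the same set are comparable. -/
theorem EndExt.total (h : EndExt A B) (h' : EndExt A C) : EndExt B C ∨ EndExt C B := by
  by_cases hBC : C ⊆ B
  · exact .inl ⟨hBC, fun y hy x hx hxy ↦ h'.2 y hy x (h.1 hx) hxy⟩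
  · obtain ⟨z, hz, hzB⟩ := not_subset.1 hBC
    refine .inr ⟨fun x hx ↦ ?_, fun y hy x hx hxy ↦ h.2 y hy x (h'.1 hx) hxy⟩
    rcases le_total x z with hxz | hxz
    · exact h'.2 z hz x (h.1 hx) hxz
    · exact absurd (h.2 x hx z (h'.1 hz) hxz) hzB

theorem IsAcc.mono {β : X} (h : IsAcc A β) (hAB : A ∩ Iio β ⊆ B) : IsAcc B β := by
  obtain ⟨⟨y, hy, hyβ⟩, h⟩ := h
  exact ⟨⟨y, hAB ⟨hy, hyβ⟩, hyβ⟩, fun x hx ↦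
    let ⟨y, hy, hxy, hyβ⟩ := h x hx; ⟨y, hAB ⟨hy, hyβ⟩, hxy, hyβ⟩⟩

theorem isAcc_of_isLUB {β : X} (h : IsLUB A β) (hA : A.Nonempty) (hβ : β ∉ A) : IsAcc A β := by
  have hlt : ∀ y ∈ A, y < β := fun y hy ↦ (h.1 hy).lt_of_ne fun h ↦ hβ (h ▸ hy)
  refine ⟨let ⟨y, hy⟩ := hA; ⟨y, hy, hlt y hy⟩, fun x hx ↦ ?_⟩
  obtain ⟨y, hy, hxy⟩ := (lt_isLUB_iff h).1 hx
  exact ⟨y, hy, hxy, hlt y hy⟩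

/-- This translates Mathlib's `IsClub` inside `Iio α` into accumulation points, the language of the
coherence clause of `SCond`. -/
theorem isClub_preimage_iff {α : X} (hC : C ⊆ Iio α) :
    IsClub ((↑) ⁻¹' C : Set (Iio α)) ↔
      (∀ β < α, IsAcc C β → β ∈ C) ∧ ∀ x < α, ∃ y ∈ C, x ≤ y := by
  constructor
  · refine fun h ↦ ⟨fun β hβ hacc ↦ ?_, fun x hx ↦ ?_⟩
    · refine h.isLUB_mem (t := {y : Iio α | (y : X) ∈ C ∧ (y : X) < β}) (x := ⟨β, hβ⟩) (fun y hy ↦ hy.1) ?_ ?_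
      · obtain ⟨y, hy, hyβ⟩ := hacc.1
        exact ⟨⟨y, hC hy⟩, hy, hyβ⟩
      · refine ⟨fun y hy ↦ le_of_lt hy.2, fun z hz ↦ ?_⟩
        by_contra hlt
        obtain ⟨y, hy, hzy, hyβ⟩ := hacc.2 z (not_le.1 hlt)
        exact absurd (hz (a := ⟨y, hC hy⟩) ⟨hy, hyβ⟩) (not_le.2 hzy)
    · obtain ⟨y, hy, hxy⟩ := h.isCofinal ⟨x, hx⟩
      exact ⟨y, hy, hxy⟩
  · rintro ⟨h, h'⟩
    refine ⟨fun d hd hne _ a ha ↦ ?_, fun x ↦ ?_⟩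
    · by_cases had : a ∈ d
      · exact hd had
      · obtain ⟨⟨y, hy, hya⟩, hacc⟩ := isAcc_of_isLUB ha hne had
        refine h a a.2 ⟨⟨y, hd hy, hya⟩, fun x hx ↦ ?_⟩
        obtain ⟨y, hy, hxy, hya⟩ := hacc ⟨x, hx.trans a.2⟩ hx
        exact ⟨y, hd hy, hxy, hya⟩
    · obtain ⟨y, hy, hxy⟩ := h' x x.2
      exact ⟨⟨y, hC hy⟩, hy, hxy⟩

theorem exists_isLUB_of_bddAbove [WellFoundedLT X] (h : BddAbove A) : ∃ m, IsLUB A m :=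
  ⟨WellFounded.min wellFounded_lt _ h, WellFounded.min_mem wellFounded_lt _ h,
    fun _ hx ↦ WellFounded.min_le wellFounded_lt hx⟩

end LinearOrder

/-- Construction of a descending sequence along a well-order. -/
theorem exists_descending {ι : Type*} [LinearOrder ι] [WellFoundedLT ι] {X : Type*} [Nonempty X]
    (le : X → X → Prop) (good : ι → X → Prop)
    (step : ∀ i, ∀ f : ι → X, (∀ j < i, good j (f j)) → (∀ j < i, ∀ k < j, le (f j) (f k)) →
      ∃ x, good i x ∧ ∀ j < i, le x (f j)) :
    ∃ f : ι → X, (∀ i, good i (f i)) ∧ ∀ i, ∀ j < i, le (f i) (f j) := by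
  classical
  let P (i : ι) (f : ι → X) (x : X) : Prop := good i x ∧ ∀ j < i, le x (f j)
  let ext (i : ι) (F : ∀ j, j < i → X) : ι → X := fun j ↦ if h : j < i then F j h else 
    Classical.arbitrary X
  let f : ι → X := wellFounded_lt.fix fun i F ↦ Classical.epsilon (P i (ext i F))
  have hf : ∀ i, f i = Classical.epsilon (P i (ext i fun j _ ↦ f j)) := fun i ↦
    WellFounded.fix_eq _ _ i
  have key : ∀ i, P i f (f i) := by
    intro i
    induction i using WellFoundedLT.induction with
    | ind i ih =>
      -- The arbitrary values of `ext` at indices not below `i` are harmless, since `P i` only reads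
      -- values below `i`.
      have hP : P i (ext i fun j _ ↦ f j) = P i f := by
        funext x
        simp only [P, ext]
        refine propext (and_congr_right fun _ ↦ forall₂_congr fun j hj ↦ ?_)
        rw [dif_pos hj]
      have := Classical.epsilon_spec (step i f (fun j hj ↦ (ih j hj).1) fun j hj k hk ↦ (ih j hj).2 k hk)
      rw [hf, hP]
      exact this
  exact ⟨f, fun i ↦ (key i).1, fun i ↦ (key i).2⟩

/-! ## Ordinals below a regular cardinal -/

section Regular

variable {κ : Cardinal.{u}}

theorem exists_forall_lt (hκ : κ.IsRegular) {A : Set (K κ)} (hA : #A < κ) : ∃ b, ∀ a ∈ A, a < b := by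
  have h : ¬ IsCofinal A := fun h ↦ by
    have := Order.cof_le h
    rw [Ordinal.cof_toType, hκ.cof_ord] at this
    exact absurd hA (not_lt.2 this)
  rw [not_isCofinal_iff] at h
  exact h

theorem bddAbove_of_mk_lt (hκ : κ.IsRegular) {A : Set (K κ)} (hA : #A < κ) : BddAbove A :=
  let ⟨b, hb⟩ := exists_forall_lt hκ hA; ⟨b, fun a ha ↦ (hb a ha).le⟩

theorem mk_Iio_lt (x : K κ) : #(Iio x) < κ :=
  by simpa using Cardinal.mk_Iio_lt x

theorem nonempty_K (hκ : κ.IsRegular) : Nonempty (K κ) :=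
  Cardinal.nonempty_ord_toType hκ.pos.ne'

theorem noMaxOrder_K (hκ : κ.IsRegular) : NoMaxOrder (K κ) :=
  Cardinal.noMaxOrder hκ.aleph0_le

theorem mk_Iic_lt (hκ : κ.IsRegular) (x : K κ) : #(Iic x) < κ := by
  have := noMaxOrder_K hκ
  obtain ⟨y, hy⟩ := exists_gt x
  exact (mk_le_mk_of_subset (Iic_subset_Iio.2 hy)).trans_lt (mk_Iio_lt y)

theorem mk_lt_of_bddAbove (hκ : κ.IsRegular) {A : Set (K κ)} (hA : BddAbove A) : #A < κ :=
  let ⟨b, hb⟩ := hA; (mk_le_mk_of_subset fun _ h ↦ hb h).trans_lt (mk_Iic_lt hκ b)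

theorem exists_isSuccPrelimit_gt (hκ : κ.IsRegular) (hκ' : ℵ₀ < κ) (x : K κ) :
    ∃ y, x < y ∧ Order.IsSuccPrelimit y := by
  have := noMaxOrder_K hκ
  let f : ℕ → K κ := fun n ↦ Order.succ^[n] x
  have hf : ∀ n, f n < f (n + 1) := fun n ↦ by
    simp only [f, Function.iterate_succ_apply']
    exact Order.lt_succ _
  have hb : BddAbove (range f) := bddAbove_of_mk_lt hκ
    ((mk_le_aleph0_iff.2 (countable_range f).to_subtype).trans_lt hκ')
  obtain ⟨m, hm⟩ := exists_isLUB_of_bddAbove hb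
  have hlt : ∀ n, f n < m := fun n ↦ (hf n).trans_le (hm.1 ⟨_, rfl⟩)
  refine ⟨m, hlt 0, fun b hb ↦ ?_⟩
  obtain ⟨_, ⟨n, rfl⟩, hn⟩ := (lt_isLUB_iff hm).1 hb.1
  exact hb.2 hn (hlt n)

end Regular

end SquareThread

namespace SquareThread

/-! ## The forcing adding a square sequence -/

theorem IsAcc.isSuccPrelimit {X : Type*} [LinearOrder X] {C : Set X} {β : X} (h : IsAcc C β) :
    Order.IsSuccPrelimit β := fun b hb ↦
  let ⟨_, _, hby, hyβ⟩ := h.2 b hb.1; hb.2 hby hyβ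

namespace SCond

variable {κ : Cardinal.{u}}

theorem le_of_le_of_le {r s t : SCond κ} (h : r ≤ s) (h' : r ≤ t) (hst : t.top ≤ s.top) : s ≤ t :=
  ⟨hst, fun α hα ↦ (h.2 α (hα.trans hst)).symm.trans (h'.2 α hα)⟩

theorem mem_of_isAcc (s : SCond κ) {α β : K κ} (hα : α ≤ s.top) (hβ : β < α)
    (h : IsAcc (s.C α) β) : β ∈ s.C α :=
  ((isClub_preimage_iff (s.subset α hα)).1 (s.isClub α hα)).1 β hβ h

theorem exists_ge (s : SCond κ) {α x : K κ} (hα : α ≤ s.top) (hx : x < α) : ∃ y ∈ s.C α, x ≤ y :=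
  ((isClub_preimage_iff (s.subset α hα)).1 (s.isClub α hα)).2 x hx

/-- `s ≤ t`, and the last entry of `s` end-extends the last entry of `t`. -/
def LeTop (s t : SCond κ) : Prop := s ≤ t ∧ EndExt (s.C s.top) (t.C t.top)

theorem LeTop.refl (s : SCond κ) : LeTop s s := ⟨le_rfl, .refl _⟩

theorem LeTop.trans {r s t : SCond κ} (h : LeTop r s) (h' : LeTop s t) : LeTop r t :=
  ⟨h.1.trans h'.1, h.2.trans h'.2⟩

theorem LeTop.total {r s t : SCond κ} (h : LeTop r s) (h' : LeTop r t) :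
    LeTop s t ∨ LeTop t s := by
  wlog hst : t.top ≤ s.top generalizing s t
  · exact (this h' h (le_of_not_ge hst)).symm
  have hle := le_of_le_of_le h.1 h'.1 hst
  rcases h.2.total h'.2 with hE | hE
  · exact .inl ⟨hle, hE⟩
  -- If `t.top < s.top`, the entry of `s` is cofinal in `s.top` and so cannot be contained in the
  -- entry of `t`, which lies below `t.top`.
  · rcases hst.lt_or_eq with hlt | heq
    · obtain ⟨y, hy, hty⟩ := s.exists_ge le_rfl hlt
      exact absurd (t.subset _ le_rfl (hE.1 hy)) (not_lt.2 hty)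
    · exact .inr ⟨le_of_le_of_le h'.1 h.1 heq.ge, hE⟩

theorem LeTop.symm_of_top_le {s t : SCond κ} (h : LeTop s t) (hst : s.top ≤ t.top) : LeTop t s := by
  have heq : s.top = t.top := le_antisymm hst h.1.1
  refine ⟨⟨hst, fun α hα ↦ (h.1.2 α (hα.trans hst)).symm⟩, ?_⟩
  rw [heq, h.1.2 _ le_rfl]
  exact .refl _

theorem exists_isSuccPrelimit_top (hκ : κ.IsRegular) :
    ∃ s : SCond κ, Order.IsSuccPrelimit s.top := by
  have := nonempty_K hκ
  let m : K κ := WellFounded.min wellFounded_lt univ univ_nonempty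
  have hm : IsBot m := fun x ↦ WellFounded.min_le wellFounded_lt (mem_univ x)
  refine ⟨⟨m, fun _ ↦ ∅, fun _ _ ↦ empty_subset _, fun α hα ↦ ?_, fun α hα β hβ ↦ ?_,
    fun α hα β hβ ↦ ?_, fun _ _ ↦ rfl⟩, fun b hb ↦ (hm b).not_gt hb.1⟩
  · exact (isClub_preimage_iff (empty_subset _)).2 ⟨fun β hβ ↦ ((hm β).not_gt (hβ.trans_le hα)).elim,
      fun β hβ ↦ ((hm β).not_gt (hβ.trans_le hα)).elim⟩
  · exact ((hm β).not_gt (hβ.1.trans_le hα)).elim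
  · obtain ⟨⟨y, hy, -⟩, -⟩ := hβ
    exact hy.elim

open Classical in
/-- The entries of an extension of `s` past `s.top`: the successor entries are forced, and at
limits the entry continues the `δ`-th entry of `s`. -/
noncomputable def extendEntry (s : SCond κ) (δ τ α : K κ) : Set (K κ) :=
  if α ≤ s.top then s.C α else if α ≤ τ then
    if Order.IsSuccPrelimit α then s.C δ ∪ {δ} ∪ Ioo s.top α else {β | β ⋖ α} else ∅

/-- Conditions can be extended to any length, continuing any given entry at the new limits. -/
theorem exists_extend (s : SCond κ) {δ τ : K κ} (hδ : δ ≤ s.top) (hτ : s.top < τ) :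
    ∃ t ≤ s, t.top = τ ∧ (Order.IsSuccPrelimit τ → EndExt (t.C τ) (s.C δ)) := by
  have h₁ : ∀ α ≤ s.top, s.extendEntry δ τ α = s.C α := fun α h ↦ if_pos h
  have h₂ : ∀ α, s.top < α → α ≤ τ → Order.IsSuccPrelimit α →
      s.extendEntry δ τ α = s.C δ ∪ {δ} ∪ Ioo s.top α := fun α h h' hl ↦ by
    rw [extendEntry, if_neg (not_le.2 h), if_pos h', if_pos hl]
  have h₃ : ∀ α, s.top < α → α ≤ τ → ∀ β, β ⋖ α → s.extendEntry δ τ α = {β} := fun α h h' β hβ ↦ by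
    rw [extendEntry, if_neg (not_le.2 h), if_pos h', if_neg fun hl ↦ hl β hβ]
    ext γ
    exact ⟨fun hγ ↦ hγ.unique_left hβ, fun hγ ↦ (mem_singleton_iff.1 hγ) ▸ hβ⟩
  have hcase : ∀ α : K κ, Order.IsSuccPrelimit α ∨ ∃ β, β ⋖ α := fun α ↦ by
    by_contra! h
    exact h.1 h.2
  have hCδ : ∀ x ∈ s.C δ, x < δ := fun x hx ↦ s.subset δ hδ hx
  -- No accumulation point falls in the gap `(δ, s.top]`. Hence the new entries only have to cohere
  -- with `C δ`, with the entries at its accumulation points, and with one another.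
  have hacc : ∀ α, s.top < α → ∀ β, IsAcc (s.C δ ∪ {δ} ∪ Ioo s.top α) β →
      (β = δ ∨ β < δ ∧ IsAcc (s.C δ) β) ∨ s.top < β ∧ β ≤ α := by
    intro α hα β hβ
    rcases le_or_gt β δ with h | h
    · refine .inl (h.eq_or_lt.imp_right fun h ↦ ⟨h, hβ.mono ?_⟩)
      rintro x ⟨(hx | rfl) | hx, hxβ⟩
      · exact hx
      · exact absurd h (not_lt.2 (le_of_lt hxβ))
      · exact absurd (hx.1.trans hxβ) (not_lt.2 (h.le.trans hδ))
    · refine .inr ⟨?_, ?_⟩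
      · obtain ⟨y, (hy | rfl) | hy, hδy, hyβ⟩ := hβ.2 δ h
        · exact absurd (hCδ y hy) (not_lt.2 hδy.le)
        · exact absurd hδy (lt_irrefl _)
        · exact hy.1.trans hyβ
      · by_contra hlt
        obtain ⟨y, (hy | rfl) | hy, hαy, hyβ⟩ := hβ.2 α (not_le.1 hlt)
        · exact absurd ((hCδ y hy).trans_le hδ) (not_lt.2 (hα.trans hαy).le)
        · exact absurd hδ (not_le.2 (hα.trans hαy))
        · exact absurd hy.2 (not_lt.2 hαy.le)
  have hsub : ∀ α ≤ τ, s.extendEntry δ τ α ⊆ Iio α := by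
    intro α hα
    rcases le_or_gt α s.top with h | h
    · rw [h₁ α h]
      exact s.subset α h
    · rcases hcase α with hl | ⟨β, hβ⟩
      · rw [h₂ α h hα hl]
        rintro x ((hx | rfl) | hx)
        · exact (hCδ x hx).trans (hδ.trans_lt h)
        · exact hδ.trans_lt h
        · exact hx.2
      · rw [h₃ α h hα β hβ]
        rintro x rfl
        exact hβ.1
  refine ⟨⟨τ, s.extendEntry δ τ, hsub, fun α hα ↦ ?_, fun α hα β hβ ↦ ?_, fun α hα β hβ ↦ ?_,
    fun α hα ↦ ?_⟩, ⟨hτ.le, h₁⟩, rfl, fun hl ↦ ?_⟩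
  · rw [isClub_preimage_iff (hsub α hα)]
    rcases le_or_gt α s.top with h | h
    · rw [h₁ α h]
      exact ⟨fun β hβ ↦ s.mem_of_isAcc h hβ, fun x hx ↦ s.exists_ge h hx⟩
    · rcases hcase α with hl | ⟨γ, hγ⟩
      · rw [h₂ α h hα hl]
        refine ⟨fun β hβ hβacc ↦ ?_, fun x hx ↦ ?_⟩
        · rcases hacc α h β hβacc with (rfl | ⟨hβδ, hβ'⟩) | hβ'
          · exact .inl (.inr rfl)
          · exact .inl (.inl (s.mem_of_isAcc hδ hβδ hβ'))
          · exact .inr ⟨hβ'.1, hβ⟩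
        · have : ¬ max x s.top ⋖ α := hl _
          rw [not_covBy_iff (max_lt hx h)] at this
          obtain ⟨y, hy, hyα⟩ := this
          exact ⟨y, .inr ⟨(le_max_right _ _).trans_lt hy, hyα⟩, (le_max_left _ _).trans hy.le⟩
      · rw [h₃ α h hα γ hγ]
        refine ⟨fun β hβ hβacc ↦ ?_, fun x hx ↦ ⟨γ, rfl, hγ.le_of_lt hx⟩⟩
        obtain ⟨⟨y, rfl, hy⟩, hβacc⟩ := hβacc
        obtain ⟨z, rfl, hz, -⟩ := hβacc _ hy
        exact absurd hz (lt_irrefl _)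
  · rcases le_or_gt α s.top with h | h
    · exact (h₁ α h).trans (s.succ α h β hβ)
    · exact h₃ α h hα β hβ
  · rcases le_or_gt α s.top with h | h
    · have hβα : β ≤ α := by
        by_contra hlt
        obtain ⟨y, hy, hαy, -⟩ := hβ.2 α (not_le.1 hlt)
        exact absurd (hsub α hα hy) (not_lt.2 hαy.le)
      rw [h₁ α h] at hβ ⊢
      rw [h₁ β (hβα.trans h)]
      exact s.coherent α h β hβ
    · rcases hcase α with hl | ⟨γ, hγ⟩
      · have hβl := hβ.isSuccPrelimit
        rw [h₂ α h hα hl] at hβ ⊢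
        rcases hacc α h β hβ with (rfl | ⟨hβδ, hβ'⟩) | hβ'
        · rw [h₁ β hδ]
          ext x
          refine ⟨?_, fun hx ↦ ⟨.inl (.inl hx), hCδ x hx⟩⟩
          rintro ⟨(hx | rfl) | hx, hxβ⟩
          · exact hx
          · exact (lt_irrefl x hxβ).elim
          · exact absurd (hx.1.trans hxβ) (not_lt.2 hδ)
        · rw [h₁ β (hβδ.le.trans hδ), ← s.coherent δ hδ β hβ']
          ext x
          refine ⟨?_, fun hx ↦ ⟨.inl (.inl hx.1), hx.2⟩⟩
          rintro ⟨(hx | rfl) | hx, hxβ⟩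
          · exact ⟨hx, hxβ⟩
          · exact absurd hβδ (lt_asymm hxβ)
          · exact absurd (hx.1.trans hxβ) (not_lt.2 (hβδ.le.trans hδ))
        · rw [h₂ β hβ'.1 (hβ'.2.trans hα) hβl]
          ext x
          constructor
          · rintro ⟨(hx | rfl) | hx, hxβ⟩
            · exact .inl (.inl hx)
            · exact .inl (.inr rfl)
            · exact .inr ⟨hx.1, hxβ⟩
          · rintro ((hx | rfl) | hx)
            · exact ⟨.inl (.inl hx), (hCδ x hx).trans (hδ.trans_lt hβ'.1)⟩
            · exact ⟨.inl (.inr rfl), hδ.trans_lt hβ'.1⟩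
            · exact ⟨.inr ⟨hx.1, hx.2.trans_le hβ'.2⟩, hx.2⟩
      · rw [h₃ α h hα γ hγ] at hβ
        obtain ⟨⟨y, rfl, hy⟩, hβacc⟩ := hβ
        obtain ⟨z, rfl, hz, -⟩ := hβacc _ hy
        exact absurd hz (lt_irrefl _)
  · rw [extendEntry, if_neg (not_le.2 (hτ.trans hα)), if_neg (not_le.2 hα)]
  · change EndExt (s.extendEntry δ τ τ) (s.C δ)
    rw [h₂ τ hτ le_rfl hl]
    refine ⟨fun x hx ↦ .inl (.inl hx), ?_⟩
    rintro y hy x ((hx | rfl) | hx) hxy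
    · exact hx
    · exact absurd (hCδ y hy) (not_lt.2 hxy)
    · exact absurd (hxy.trans_lt (hCδ y hy)) (not_lt.2 (hδ.trans hx.1.le))

/-! ### Lower bounds for chains of square conditions -/

open Classical in
/-- The entries of the union of a chain of conditions whose tops have supremum `m`. -/
noncomputable def unionEntry {ι : Type*} (s : ι → SCond κ) (m α : K κ) : Set (K κ) :=
  if α < m then {ξ | ∃ i, α ≤ (s i).top ∧ ξ ∈ (s i).C α} else
    if α = m then {ξ | ∃ i, ξ ∈ (s i).C (s i).top} else ∅

/-- Comparability under `LeTop` rather than `≤` is essential: the coherent last entries supply the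
club needed as entry at the supremum of the tops. -/
theorem exists_leTop (hκ : κ.IsRegular) {ι : Type u} (hι : #ι < κ) (s : ι → SCond κ)
    (hs : ∀ i, Order.IsSuccPrelimit (s i).top) (hle : ∀ i j, LeTop (s i) (s j) ∨ LeTop (s j) (s i)) :
    ∃ t : SCond κ, Order.IsSuccPrelimit t.top ∧ ∀ i, LeTop t (s i) := by
  rcases isEmpty_or_nonempty ι with _ | hne
  · obtain ⟨t, ht⟩ := exists_isSuccPrelimit_top hκ
    exact ⟨t, ht, fun i ↦ isEmptyElim i⟩
  obtain ⟨m, hm⟩ := exists_isLUB_of_bddAbove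
    (bddAbove_of_mk_lt hκ (mk_range_le.trans_lt hι : #(range fun i ↦ (s i).top) < κ))
  -- If the supremum is attained, that condition is itself a lower bound. Otherwise a new entry has
  -- to be created at `m`.
  by_cases hmax : ∃ i, (s i).top = m
  · obtain ⟨i, hi⟩ := hmax
    refine ⟨s i, hs i, fun j ↦ (hle i j).elim id fun h ↦ h.symm_of_top_le ?_⟩
    exact hi ▸ hm.1 (mem_range_self j)
  push Not at hmax
  have hlt : ∀ i, (s i).top < m := fun i ↦ (hm.1 (mem_range_self i)).lt_of_ne (hmax i)
  have hex : ∀ α < m, ∃ i, α < (s i).top := fun α hα ↦ by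
    obtain ⟨_, ⟨i, rfl⟩, hi⟩ := (lt_isLUB_iff hm).1 hα
    exact ⟨i, hi⟩
  have h₁ : ∀ i, ∀ α ≤ (s i).top, unionEntry s m α = (s i).C α := by
    intro i α hα
    rw [unionEntry, if_pos (hα.trans_lt (hlt i))]
    ext ξ
    refine ⟨fun ⟨j, hj, hξ⟩ ↦ ?_, fun hξ ↦ ⟨i, hα, hξ⟩⟩
    rcases hle i j with h | h
    · rwa [h.1.2 α hj]
    · rwa [← h.1.2 α hα]
  have h₂ : unionEntry s m m = {ξ | ∃ i, ξ ∈ (s i).C (s i).top} := by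
    rw [unionEntry, if_neg (lt_irrefl _), if_pos rfl]
  -- Below `(s i).top` the union adds nothing to the last entry of `s i`. Closure and coherence of
  -- the new entry thus reduce to those of a single `s i`.
  have hU : ∀ i, ∀ ξ ∈ unionEntry s m m, ξ < (s i).top → ξ ∈ (s i).C (s i).top := by
    intro i ξ hξ hξi
    rw [h₂] at hξ
    obtain ⟨j, hξ⟩ := hξ
    rcases hle i j with h | h
    · exact h.2.1 hξ
    · obtain ⟨y, hy, hξy⟩ := (s i).exists_ge le_rfl hξi
      exact h.2.2 y hy ξ hξ hξy
  have hU' : ∀ i, (s i).C (s i).top ⊆ unionEntry s m m := fun i ξ hξ ↦ h₂ ▸ ⟨i, hξ⟩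
  have hsub : ∀ α ≤ m, unionEntry s m α ⊆ Iio α := by
    intro α hα
    rcases hα.lt_or_eq with hα | rfl
    · obtain ⟨i, hi⟩ := hex α hα
      rw [h₁ i α hi.le]
      exact (s i).subset α hi.le
    · rw [h₂]
      rintro ξ ⟨i, hξ⟩
      exact ((s i).subset _ le_rfl hξ).trans (hlt i)
  have hacc : ∀ i, ∀ β ≤ (s i).top, IsAcc (unionEntry s m m) β → IsAcc ((s i).C (s i).top) β :=
    fun i β hβ h ↦ h.mono fun x hx ↦ hU i x hx.1 (hx.2.trans_le hβ)
  refine ⟨⟨m, unionEntry s m, hsub, fun α hα ↦ ?_, fun α hα β hβ ↦ ?_, fun α hα β hβ ↦ ?_,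
    fun α hα ↦ ?_⟩, fun b hb ↦ ?_, fun i ↦ ⟨⟨(hlt i).le, fun α hα ↦ h₁ i α hα⟩, hU' i, ?_⟩⟩
  · rw [isClub_preimage_iff (hsub α hα)]
    rcases hα.lt_or_eq with hα | rfl
    · obtain ⟨i, hi⟩ := hex α hα
      rw [h₁ i α hi.le]
      exact ⟨fun β hβ ↦ (s i).mem_of_isAcc hi.le hβ, fun x hx ↦ (s i).exists_ge hi.le hx⟩
    · refine ⟨fun β hβ hβacc ↦ ?_, fun x hx ↦ ?_⟩
      · obtain ⟨i, hi⟩ := hex β hβ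
        exact hU' i ((s i).mem_of_isAcc le_rfl hi (hacc i β hi.le hβacc))
      · obtain ⟨i, hi⟩ := hex x hx
        obtain ⟨y, hy, hxy⟩ := (s i).exists_ge le_rfl hi
        exact ⟨y, hU' i hy, hxy⟩
  · rcases hα.lt_or_eq with hα | rfl
    · obtain ⟨i, hi⟩ := hex α hα
      exact (h₁ i α hi.le).trans ((s i).succ α hi.le β hβ)
    · obtain ⟨i, hi⟩ := hex β hβ.1
      exact (hβ.2 hi (hlt i)).elim
  · have hβα : β ≤ α := by
      by_contra hlt
      obtain ⟨y, hy, hαy, -⟩ := hβ.2 α (not_le.1 hlt)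
      exact absurd (hsub α hα hy) (not_lt.2 hαy.le)
    rcases hα.lt_or_eq with hα | rfl
    · obtain ⟨i, hi⟩ := hex α hα
      rw [h₁ i α hi.le] at hβ ⊢
      rw [h₁ i β (hβα.trans hi.le)]
      exact (s i).coherent α hi.le β hβ
    · rcases hβα.lt_or_eq with hβα | rfl
      · obtain ⟨i, hi⟩ := hex β hβα
        rw [h₁ i β hi.le, ← (s i).coherent _ le_rfl β (hacc i β hi.le hβ)]
        ext ξ
        exact ⟨fun h ↦ ⟨hU i ξ h.1 (lt_trans h.2 hi), h.2⟩, fun h ↦ ⟨hU' i h.1, h.2⟩⟩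
      · exact inter_eq_left.2 (hsub β le_rfl)
  · rw [unionEntry, if_neg hα.le.not_gt, if_neg hα.ne']
  · obtain ⟨i, hi⟩ := hex b hb.1
    exact hb.2 hi (hlt i)
  · exact fun y hy x hx hxy ↦ hU i x hx (hxy.trans_lt ((s i).subset _ le_rfl hy))

end SCond

end SquareThread

namespace SquareThread

/-! ## Generalities on the forcing relation -/

namespace Stmt

variable {P : Type u} [Preorder P] {X : Type u}

theorem mem_mono {x : X} {A : Name P X} {p q : P} (h : mem x A p) (hqp : q ≤ p) : mem x A q :=
  fun r hr ↦ h r (hr.trans hqp)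

theorem neg_mono {φ : Stmt P} {p q : P} (h : neg φ p) (hqp : q ≤ p) : neg φ q :=
  fun r hr ↦ h r (hr.trans hqp)

theorem exists_decide (φ : Stmt P) (p : P) : ∃ q ≤ p, φ q ∨ neg φ q := by
  by_cases h : ∃ q ≤ p, φ q
  · exact let ⟨q, hq, hφ⟩ := h; ⟨q, hq, .inl hφ⟩
  · exact ⟨p, le_rfl, .inr fun q hq hφ ↦ h ⟨q, hq, hφ⟩⟩

theorem mem_const_iff {x : X} {C : Set X} {p : P} :
    mem x (fun y ↦ {_q : P | y ∈ C}) p ↔ x ∈ C :=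
  ⟨fun h ↦ let ⟨_, _, _, ha, _⟩ := h p le_rfl; ha, fun h q _ ↦ ⟨q, le_rfl, q, h, le_rfl⟩⟩

theorem not_mem_empty {x : X} {p : P} : ¬ mem x (fun _ ↦ (∅ : Set P)) p :=
  fun h ↦ let ⟨_, _, _, ha, _⟩ := h p le_rfl; ha

theorem endExtends_of_endExt [LinearOrder X] {A B : Name P X} {C D : Set X} {p : P}
    (hA : ∀ x, ∀ q ≤ p, mem x A q ↔ x ∈ C) (hB : ∀ x, ∀ q ≤ p, mem x B q ↔ x ∈ D)
    (h : EndExt C D) : endExtends A B p :=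
  ⟨fun x q hq hx ↦ (hA x q hq).2 (h.1 ((hB x q hq).1 hx)), fun y x q hq hxy ↦
    (hB x q hq).2 (h.2 y ((hB y q hq).1 hxy.1) x ((hA x q hq).1 hxy.2) x.2)⟩

theorem endExt_of_endExtends [LinearOrder X] {A B : Name P X} {C D : Set X} {p : P}
    (hA : ∀ x, mem x A p ↔ x ∈ C) (hB : ∀ x, mem x B p ↔ x ∈ D)
    (h : endExtends A B p) : EndExt C D :=
  ⟨fun x hx ↦ (hA x).1 (h.1 x p le_rfl ((hB x).2 hx)), fun y hy x hx hxy ↦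
    (hB x).1 (h.2 y ⟨x, hxy⟩ p le_rfl ⟨(hB y).2 hy, (hA x).2 hx⟩)⟩

theorem endExtends_empty [LinearOrder X] (A : Name P X) {B : Name P X} {p : P}
    (hB : ∀ x, ∀ q ≤ p, ¬ mem x B q) : endExtends A B p :=
  ⟨fun x q hq h ↦ (hB x q hq h).elim, fun y _ q hq h ↦ (hB y q hq h.1).elim⟩

end Stmt

section

variable {P : Type u} [Preorder P]

/-- A maximal antichain inside a dense set. -/
theorem exists_antichain_subset {W : Set P} (hW : IsDenseIn W) :
    ∃ A ⊆ W, (∀ a ∈ A, ∀ b ∈ A, Compatible a b → a = b) ∧ ∀ p, ∃ a ∈ A, Compatible a p := by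
  have hz : ∃ A, Maximal (· ∈ {A : Set P | A ⊆ W ∧ ∀ a ∈ A, ∀ b ∈ A, Compatible a b → a = b}) A := by
    refine zorn_subset _ fun c hc hch ↦ ⟨⋃₀ c, ⟨sUnion_subset fun A hA ↦ (hc hA).1, ?_⟩,
      fun A hA ↦ subset_sUnion_of_mem hA⟩
    rintro a ⟨A, hA, ha⟩ b ⟨B, hB, hb⟩ hab
    rcases hch.total hA hB with h | h
    · exact (hc hB).2 a (h ha) b hb hab
    · exact (hc hA).2 a ha b (h hb) hab
  obtain ⟨A, hA⟩ := hz
  refine ⟨A, hA.prop.1, hA.prop.2, fun p ↦ ?_⟩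
  obtain ⟨d, hd, hdp⟩ := hW p
  by_cases hdA : d ∈ A
  · exact ⟨d, hdA, d, le_rfl, hdp⟩
  by_contra! hcon
  have hinc : ∀ a ∈ A, ¬ Compatible a d := fun a ha ⟨r, hra, hrd⟩ ↦
    hcon a ha ⟨r, hra, hrd.trans hdp⟩
  refine hdA (hA.le_of_ge (y := insert d A) ⟨insert_subset hd hA.prop.1, ?_⟩
    (subset_insert d A) (mem_insert d A))
  rintro a (rfl | ha) b (rfl | hb) hab
  · rfl
  · exact (hinc b hb (let ⟨r, h, h'⟩ := hab; ⟨r, h', h⟩)).elim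
  · exact (hinc a ha hab).elim
  · exact hA.prop.2 a ha b hb hab

/-- If `A` is forced to be nonstationary, then there is a single name for a club disjoint from `A`;
`E m p` says that `p` forces `m` to belong to it. -/
theorem exists_club_of_isNonstationary {X : Type u} [LinearOrder X] {A : Name P X}
    (hA : ∀ p, Stmt.isNonstationary A p) :
    ∃ E : X → P → Prop, (∀ m p q, q ≤ p → E m p → E m q) ∧
      (∀ x p, ∃ q ≤ p, ∃ m, x ≤ m ∧ E m q) ∧
      (∀ m p, IsAcc {y | E y p} m → E m p) ∧
      ∀ m p, E m p → Stmt.neg (Stmt.mem m A) p := by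
  let good (F : Name P X) (p : P) : Prop := (Stmt.isClosed F p ∧ Stmt.isUnbounded F p) ∧
    Stmt.isDisjoint F A p
  -- Names of clubs are mixed along a maximal antichain of conditions that have a witness. The
  -- relation `E` expresses forced membership in the mixed name without building that name.
  obtain ⟨T, hT, hanti, hpre⟩ := exists_antichain_subset (W := {p : P | ∃ F, good F p})
    fun p ↦ let ⟨q, hq, F, hF⟩ := hA p p le_rfl; ⟨q, ⟨F, hF⟩, hq⟩
  choose! F hF using fun a (ha : a ∈ T) ↦ hT ha
  refine ⟨fun m p ↦ ∀ a ∈ T, ∀ q ≤ p, q ≤ a → Stmt.mem m (F a) q,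
    fun m p q hq h a ha r hr ↦ h a ha r (hr.trans hq), fun x p ↦ ?_, fun m p h a ha q hq hqa ↦ ?_,
    fun m p h q hq hmA ↦ ?_⟩
  · obtain ⟨a, ha, q, hqa, hqp⟩ := hpre p
    obtain ⟨r, hr, m, hm⟩ := (hF a ha).1.2 x q hqa
    refine ⟨r, hr.trans hqp, m, m.2, fun b hb s hs hsb ↦ ?_⟩
    obtain rfl := hanti a ha b hb ⟨s, hs.trans (hr.trans hqa), hsb⟩
    exact Stmt.mem_mono hm hs
  · refine (hF a ha).1.1 m q hqa ⟨fun r hr ↦ ?_, fun x r hr ↦ ?_⟩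
    · obtain ⟨y, hy, hym⟩ := h.1
      exact ⟨r, le_rfl, ⟨y, hym⟩, hy a ha r (hr.trans hq) (hr.trans hqa)⟩
    · obtain ⟨y, hy, hxy, hym⟩ := h.2 x x.2
      exact ⟨r, le_rfl, ⟨y, hxy, hym⟩, hy a ha r (hr.trans hq) (hr.trans hqa)⟩
  · obtain ⟨a, ha, r, hra, hrq⟩ := hpre q
    exact (hF a ha).2 m r hra ⟨h a ha r (hrq.trans hq) hra, Stmt.mem_mono hmA hrq⟩

/-- A forcing with a dense `κ`-directed closed subset is `κ`-distributive. -/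
theorem exists_le_forall_mem {κ : Cardinal.{u}} (hκ : ℵ₀ ≤ κ) {D : Set P} (hD : IsDenseIn D)
    (hcl : IsKDirectedClosed κ D) {ι : Type u} (hι : #ι < κ) (U : ι → P → Prop)
    (hU : ∀ i p q, q ≤ p → U i p → U i q) (p₀ : P) (hdense : ∀ i, ∀ p ≤ p₀, ∃ q ≤ p, U i q) :
    ∃ d ∈ D, d ≤ p₀ ∧ ∀ i, U i d := by
  classical
  let _ : LinearOrder ι := linearOrderOfSTO WellOrderingRel
  have : WellFoundedLT ι := inferInstanceAs (IsWellFounded ι WellOrderingRel)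
  obtain ⟨d₀, hd₀, hd₀p⟩ := hD p₀
  -- Inserting `d₀` keeps the bound below `p₀` even when `s` is empty.
  have lower : ∀ (s : Set ι) (f : ι → D), (∀ i ∈ s, f i ≤ ⟨d₀, hd₀⟩) →
      (∀ i ∈ s, ∀ j < i, j ∈ s → f i ≤ f j) → ∃ d : D, d ≤ ⟨d₀, hd₀⟩ ∧ ∀ i ∈ s, d ≤ f i := by
    intro s f hf₀ hf
    suffices h : ∃ d, ∀ p ∈ insert ⟨d₀, hd₀⟩ (f '' s), d ≤ p from
      let ⟨d, hd⟩ := h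
      ⟨d, hd _ (mem_insert _ _), fun i hi ↦ hd _ (mem_insert_of_mem _ (mem_image_of_mem f hi))⟩
    refine hcl _ ?_ ?_
    · refine mk_insert_le.trans_lt (add_lt_of_lt hκ (mk_image_le.trans_lt ?_) (one_lt_aleph0.trans_le hκ))
      exact (mk_set_le s).trans_lt hι
    · rintro a (rfl | ⟨i, hi, rfl⟩) b (rfl | ⟨j, hj, rfl⟩)
      · exact ⟨_, le_rfl, le_rfl⟩
      · exact ⟨f j, hf₀ j hj, le_rfl⟩
      · exact ⟨f i, le_rfl, hf₀ i hi⟩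
      · rcases lt_trichotomy i j with h | rfl | h
        · exact ⟨f j, hf j hj i h hi, le_rfl⟩
        · exact ⟨f i, le_rfl, le_rfl⟩
        · exact ⟨f i, le_rfl, hf i hi j h hj⟩
  have : Nonempty D := ⟨⟨d₀, hd₀⟩⟩
  obtain ⟨f, hf, hle⟩ := exists_descending (ι := ι) (X := D) (fun x y ↦ x ≤ y)
    (fun i x ↦ x ≤ ⟨d₀, hd₀⟩ ∧ U i x) fun i f hf hle ↦ by
      obtain ⟨d, hd, hdf⟩ := lower (Iio i) f (fun j hj ↦ (hf j hj).1) fun j hj k hk _ ↦ hle j hj k hk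
      obtain ⟨q, hq, hqU⟩ := hdense i d (le_trans (show (d : P) ≤ d₀ from hd) hd₀p)
      obtain ⟨e, he, heq⟩ := hD q
      have hed : (⟨e, he⟩ : D) ≤ d := heq.trans hq
      exact ⟨⟨e, he⟩, ⟨hed.trans hd, hU i q e heq hqU⟩, fun j hj ↦ hed.trans (hdf j hj)⟩
  obtain ⟨d, hd, hdf⟩ := lower univ f (fun i _ ↦ (hf i).1) fun i _ j hj _ ↦ hle i j hj
  exact ⟨d, d.2, le_trans (show (d : P) ≤ d₀ from hd) hd₀p,
    fun i ↦ hU i (f i) d (hdf i trivial) (hf i).2⟩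

theorem IsKDirectedClosed.isKClosed {κ : Cardinal.{u}} (h : IsKDirectedClosed κ P) :
    IsKClosed κ P := fun η hη p hp ↦ by
  suffices h : ∃ q, ∀ r ∈ range p, q ≤ r from
    let ⟨q, hq⟩ := h
    ⟨q, fun i ↦ hq _ (mem_range_self i)⟩
  refine h _ (mk_range_le.trans_lt (by rwa [mk_toType, ← lt_ord])) ?_
  rintro _ ⟨i, rfl⟩ _ ⟨j, rfl⟩
  rcases le_total i j with hij | hij
  · exact ⟨p j, hp hij, le_rfl⟩
  · exact ⟨p i, le_rfl, hp hij⟩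

/-! ## The threading forcing -/

variable {κ : Cardinal.{u}} {π : P → SCond κ}

theorem mem_genericSquare_iff (hπ : Monotone π) {δ ξ : K κ} {p : P} (hδ : δ ≤ (π p).top) :
    Stmt.mem ξ (genericSquare π δ) p ↔ ξ ∈ (π p).C δ := by
  refine ⟨fun h ↦ ?_, fun h q hq ↦ ⟨q, le_rfl, p, ⟨hδ, h⟩, hq⟩⟩
  obtain ⟨r, hr, a, ⟨ha, hξ⟩, hra⟩ := h p le_rfl
  rwa [← (hπ hr).2 δ hδ, (hπ hra).2 δ ha]

theorem isThreadCond_genericSquare {δ : K κ} (hδ : Order.IsSuccPrelimit δ) (p : P) :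
    isThreadCond π (genericSquare π δ) p :=
  fun q _ ↦ ⟨q, le_rfl, ⟨δ, hδ⟩, fun _ ↦ ⟨fun _ _ h ↦ h, fun _ _ h ↦ h⟩⟩

theorem isThreadCond_mono {t : Name P (K κ)} {p q : P} (h : isThreadCond π t p) (hqp : q ≤ p) :
    isThreadCond π t q := fun r hr ↦ h r (hr.trans hqp)

/-- The condition of `P * 𝕋` below `x` obtained by strengthening the first coordinate. -/
def WithThread.restrictFst (x : WithThread π) (q : P) (hq : q ≤ x.fst) : WithThread π :=
  ⟨q, x.thread, isThreadCond_mono x.forces hq⟩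

theorem WithThread.restrictFst_le (x : WithThread π) {q : P} (hq : q ≤ x.fst) :
    x.restrictFst q hq ≤ x := ⟨hq, Stmt.endExtends_refl _ _⟩

theorem not_mem_genericSquare_of_isMin {δ ξ : K κ} (hδ : IsMin δ) (p : P) :
    ¬ Stmt.mem ξ (genericSquare π δ) p := fun h ↦
  let ⟨_, _, a, ha, _⟩ := h p le_rfl
  hδ.not_lt ((π a).subset δ ha.1 ha.2)

/-- The thread of `x` is the entry at `0`, which is empty, so `x` is `p` paired with the maximal
condition of `𝕋`. -/
theorem exists_withThread_fst_eq (hκ : κ.IsRegular) (π : P → SCond κ) (p : P) :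
    ∃ x : WithThread π, x.fst = p ∧ ∀ y : WithThread π, y.fst ≤ p → y ≤ x := by
  have := nonempty_K hκ
  obtain ⟨δ, hδ⟩ : ∃ δ : K κ, IsMin δ := ⟨WellFounded.min wellFounded_lt univ univ_nonempty,
    fun x _ ↦ WellFounded.min_le wellFounded_lt (mem_univ x)⟩
  exact ⟨⟨p, genericSquare π δ, isThreadCond_genericSquare hδ.isSuccPrelimit p⟩, rfl, fun y hy ↦
    ⟨hy, Stmt.endExtends_empty _ fun ξ q _ ↦ not_mem_genericSquare_of_isMin hδ q⟩⟩

/-- Adjoining `𝕋` does not change what is forced about `P`-names: a first coordinate can be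
strengthened with the thread kept, and any `a : P` becomes a pair with empty thread. This brings
facts forced with the thread back to `P`. -/
theorem mem_lift_fst_iff (hκ : κ.IsRegular) {X : Type u} {A : Name P X} {x : X}
    {y : WithThread π} : Stmt.mem x (A.lift WithThread.fst) y ↔ Stmt.mem x A y.fst := by
  constructor
  · intro h q hq
    obtain ⟨r, hr, a, ha, hra⟩ := h _ (y.restrictFst_le hq)
    exact ⟨r.fst, hr.1, a.fst, ha, hra.1⟩
  · intro h z hz
    obtain ⟨r, hr, a, ha, hra⟩ := h z.fst hz.1
    obtain ⟨w, rfl, hw⟩ := exists_withThread_fst_eq hκ π a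
    exact ⟨z.restrictFst r hr, z.restrictFst_le hr, w, ha, hw _ hra⟩

/-- This is where the case distinction in `killed` is used. When the candidate is discarded, all of
`κ` is a club disjoint from `∅`. -/
theorem isNonstationary_killed (B : Name P (K κ)) (p : WithThread π) :
    Stmt.isNonstationary ((killed π B).lift WithThread.fst) p := by
  classical
  by_cases h : ∀ p : WithThread π, Stmt.isNonstationary (B.lift WithThread.fst) p
  · rw [killed, if_pos h]
    exact h p
  · rw [killed, if_neg h]
    refine fun q _ ↦ ⟨q, le_rfl, fun x ↦ {_r | x ∈ (Set.univ : Set (K κ))}, ⟨fun β r _ _ ↦ ?_, fun x r _ ↦ ?_⟩,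
      fun x r _ hr ↦ Stmt.not_mem_empty hr.2⟩
    · exact Stmt.mem_const_iff.2 trivial
    · exact ⟨r, le_rfl, ⟨x, self_mem_Ici⟩, Stmt.mem_const_iff.2 trivial⟩

end

end SquareThread

namespace SquareThread

variable {κ : Cardinal.{u}} {b : Bookkeeping κ} {α : WithTop (L κ)}

/-! ## The stages of the iteration -/

theorem Raw.restrict_self (p : Raw κ α) : p.restrict le_rfl = p :=
  (Raw.equiv α).injective (by simp [Raw.restrict, Raw.base, Raw.coord])

namespace SR

/-- The coordinate `p(β)`, as a name of stage `β`. -/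
noncomputable def coord (p : SR b α) (β : L κ) (h : (β : WithTop (L κ)) < α) :
    Name (SR b β) (K κ) := (p.1.coord β h).lift Subtype.val

theorem restrict_mem_valid (p : SR b α) {β : WithTop (L κ)} (h : β ≤ α) :
    p.1.restrict h ∈ (stage b β).valid := by
  rcases h.lt_or_eq with h' | rfl
  · have hβ : β = ((β.untop (ne_top_of_lt h') : L κ) : WithTop (L κ)) := (WithTop.coe_untop _ _).symm
    generalize β.untop (ne_top_of_lt h') = γ at hβ
    subst hβ
    exact (((mem_stage_valid_iff b α p.1).1 p.2).2 γ h').1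
  · rw [Raw.restrict_self]
    exact p.2

/-- The restriction of a condition to an earlier stage. -/
noncomputable def restrict (p : SR b α) {β : WithTop (L κ)} (h : β ≤ α) : SR b β :=
  ⟨p.1.restrict h, p.restrict_mem_valid h⟩

theorem toS_mono : Monotone (toS : SR b α → SCond κ) := fun p q h ↦
  ((stage_le_iff b α p.1 q.1).1 h).1

theorem le_iff {p q : SR b α} : p ≤ q ↔ p.toS ≤ q.toS ∧
    ∀ (β : L κ) (h : (β : WithTop (L κ)) < α),
      Stmt.endExtends (p.coord β h) (q.coord β h) (p.restrict h.le) :=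
  (stage_le_iff b α p.1 q.1).trans (and_congr_right fun _ ↦
    ⟨fun H β h ↦ H β h (p.restrict h.le).2, fun H β h _ ↦ H β h⟩)

/-- The name of the set to be killed at stage `β`. -/
noncomputable def killedAt (b : Bookkeeping κ) (β : L κ) : Name (SR b β) (K κ) :=
  killed SR.toS ((b.candidate β).lift Subtype.val)

theorem isClubShooting_coord (p : SR b α) (β : L κ) (h : (β : WithTop (L κ)) < α) :
    Stmt.isClubShooting (killedAt b β) (p.coord β h) (p.restrict h.le) :=
  (((mem_stage_valid_iff b α p.1).1 p.2).2 β h).2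

theorem mk_support_lt (p : SR b α) :
    #{β : L κ // ∃ h : (β : WithTop (L κ)) < α, p.1.coord β h ≠ fun _ ↦ ∅} < κ :=
  ((mem_stage_valid_iff b α p.1).1 p.2).1

end SR

/-- One club is fixed per stage, so that the maxima of different conditions are points of the same
closed set. -/
theorem exists_inClub (b : Bookkeeping κ) (β : L κ) : ∃ E : K κ → SRT b β → Prop,
    (∀ m x y, y ≤ x → E m x → E m y) ∧ (∀ z x, ∃ y ≤ x, ∃ m, z ≤ m ∧ E m y) ∧
      (∀ m x, IsAcc {y | E y x} m → E m x) ∧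
      ∀ m x, E m x → Stmt.neg (Stmt.mem m ((SR.killedAt b β).lift WithThread.fst)) x :=
  exists_club_of_isNonstationary (isNonstationary_killed _)

/-- `x` forces `m` to belong to a fixed club disjoint from the set killed at stage `β`. -/
def inClub (b : Bookkeeping κ) (β : L κ) : K κ → SRT b β → Prop :=
  Classical.choose (exists_inClub b β)

section

variable {β : L κ} {m : K κ} {x : SRT b β}

theorem inClub_mono {y : SRT b β} (h : y ≤ x) (hx : inClub b β m x) : inClub b β m y :=
  (Classical.choose_spec (exists_inClub b β)).1 m x y h hx

theorem exists_inClub_ge (z : K κ) (x : SRT b β) : ∃ y ≤ x, ∃ m, z ≤ m ∧ inClub b β m y :=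
  (Classical.choose_spec (exists_inClub b β)).2.1 z x

theorem inClub_of_isAcc (h : IsAcc {y | inClub b β y x} m) : inClub b β m x :=
  (Classical.choose_spec (exists_inClub b β)).2.2.1 m x h

/-- The hypothesis involves the thread but the conclusion does not: the club exists only after
forcing with `𝕋`, while the killed set already has a name at stage `β`. -/
theorem not_mem_killedAt_of_inClub (hκ : κ.IsRegular) (h : inClub b β m x) :
    Stmt.neg (Stmt.mem m (SR.killedAt b β)) x.fst := fun q hq hm ↦
  (Classical.choose_spec (exists_inClub b β)).2.2.2 m x h (x.restrictFst q hq)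
    (x.restrictFst_le hq) ((mem_lift_fst_iff hκ).2 hm)

end

/-! ## Conditions all of whose coordinates are sets in the ground model -/

/-- An element of `𝕊` together with sets in the ground model for all coordinates. -/
structure GroundCond (κ : Cardinal.{u}) : Type u where
  s : SCond κ
  c : L κ → Set (K κ)

instance : Preorder (GroundCond κ) where
  le g h := SCond.LeTop g.s h.s ∧ ∀ β, EndExt (g.c β) (h.c β)
  le_refl g := ⟨.refl _, fun _ ↦ .refl _⟩
  le_trans _ _ _ h h' := ⟨h.1.trans h'.1, fun β ↦ (h.2 β).trans (h'.2 β)⟩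

namespace GroundCond

/-- The raw condition with the same coordinates below `α`. -/
noncomputable def toRaw (g : GroundCond κ) (α : WithTop (L κ)) : Raw κ α :=
  (Raw.equiv α).symm (g.s, fun β _ x ↦ {_q | x ∈ g.c β})

@[simp] theorem base_toRaw (g : GroundCond κ) : (g.toRaw α).base = g.s := by
  simp [toRaw, Raw.base]

@[simp] theorem coord_toRaw (g : GroundCond κ) (β : L κ) (h : (β : WithTop (L κ)) < α) :
    (g.toRaw α).coord β h = fun x ↦ {_q | x ∈ g.c β} := by
  simp [toRaw, Raw.coord]

@[simp] theorem restrict_toRaw (g : GroundCond κ) {β : WithTop (L κ)} (h : β ≤ α) :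
    (g.toRaw α).restrict h = g.toRaw β := by
  simp [Raw.restrict, toRaw, Raw.base, Raw.coord]

theorem toRaw_congr {g h : GroundCond κ} (hs : g.s = h.s)
    (hc : ∀ β : L κ, (β : WithTop (L κ)) < α → g.c β = h.c β) : g.toRaw α = h.toRaw α := by
  unfold toRaw
  congr 1
  refine Prod.ext hs (funext₂ fun β hβ ↦ ?_)
  simp [hc β hβ]

theorem coord_eq {p : SR b α} {g : GroundCond κ} (hp : p.1 = g.toRaw α) (β : L κ)
    (h : (β : WithTop (L κ)) < α) : p.coord β h = fun x ↦ {_q | x ∈ g.c β} := by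
  rw [SR.coord, hp, coord_toRaw]
  rfl

theorem toS_eq {p : SR b α} {g : GroundCond κ} (hp : p.1 = g.toRaw α) : p.toS = g.s := by
  rw [← base_toRaw (α := α) g, ← hp]
  rfl

theorem le_of_le {p q : SR b α} {g h : GroundCond κ} (hp : p.1 = g.toRaw α) (hq : q.1 = h.toRaw α)
    (hgh : g ≤ h) : p ≤ q := by
  refine SR.le_iff.2 ⟨by rw [toS_eq hp, toS_eq hq]; exact hgh.1.1, fun β hβ ↦ ?_⟩
  rw [coord_eq hp, coord_eq hq]
  exact Stmt.endExtends_of_endExt (fun _ _ _ ↦ Stmt.mem_const_iff) (fun _ _ _ ↦ Stmt.mem_const_iff)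
    (hgh.2 β)

theorem thread_endExtends {p : SR b α} {g h : GroundCond κ} (hp : p.1 = g.toRaw α)
    (hgh : SCond.LeTop g.s h.s) : Stmt.endExtends (genericSquare SR.toS g.s.top)
      (genericSquare SR.toS h.s.top) p := by
  have hle : ∀ q ≤ p, SR.toS q ≤ g.s := fun q hq ↦ toS_eq hp ▸ SR.toS_mono hq
  refine Stmt.endExtends_of_endExt (fun x q hq ↦ ?_) (fun x q hq ↦ ?_) hgh.2
  · rw [mem_genericSquare_iff SR.toS_mono (hle q hq).1, (hle q hq).2 _ le_rfl]
  · rw [mem_genericSquare_iff SR.toS_mono ((hle q hq).trans hgh.1).1,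
      ((hle q hq).trans hgh.1).2 _ le_rfl]

theorem srt_le_of_le {x y : SRT b α} {g h : GroundCond κ} (hx : x.fst.1 = g.toRaw α)
    (hx' : x.thread = genericSquare SR.toS g.s.top) (hy : y.fst.1 = h.toRaw α)
    (hy' : y.thread = genericSquare SR.toS h.s.top) (hgh : g ≤ h) : x ≤ y := by
  refine ⟨le_of_le hx hy hgh, ?_⟩
  rw [hx', hy']
  exact thread_endExtends hx hgh.1

/-- Forced end-extension between names of ground model sets is true end-extension. The order of
stage `α` ignores coordinates outside `α`, hence the assumption `hh`. -/
theorem le_of_srt_le {x y : SRT b α} {g h : GroundCond κ} (hx : x.fst.1 = g.toRaw α)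
    (hx' : x.thread = genericSquare SR.toS g.s.top) (hy : y.fst.1 = h.toRaw α)
    (hy' : y.thread = genericSquare SR.toS h.s.top)
    (hh : ∀ β : L κ, ¬ (β : WithTop (L κ)) < α → h.c β = ∅) (hxy : x ≤ y) : g ≤ h := by
  have h₁ := SR.le_iff.1 hxy.1
  have h₂ := hxy.2
  rw [toS_eq hx, toS_eq hy] at h₁
  rw [hx', hy'] at h₂
  refine ⟨⟨h₁.1, Stmt.endExt_of_endExtends (fun ξ ↦ ?_) (fun ξ ↦ ?_) h₂⟩, fun β ↦ ?_⟩
  · rw [mem_genericSquare_iff SR.toS_mono (by rw [toS_eq hx]), toS_eq hx]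
  · rw [mem_genericSquare_iff SR.toS_mono (by rw [toS_eq hx]; exact h₁.1.1), toS_eq hx,
      h₁.1.2 _ le_rfl]
  · by_cases hβ : (β : WithTop (L κ)) < α
    · have := h₁.2 β hβ
      rw [coord_eq hx, coord_eq hy] at this
      exact Stmt.endExt_of_endExtends (fun _ ↦ Stmt.mem_const_iff) (fun _ ↦ Stmt.mem_const_iff) this
    · rw [hh β hβ]
      exact .empty _

/-- The ground model conditions which give the dense subset of `𝕊 * ℝ_α * 𝕋`: the thread is the
last entry of the square sequence, and the last element of each coordinate is forced to be in the
club which witnesses that the set killed there is nonstationary. -/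
structure IsGood (b : Bookkeeping κ) (g : GroundCond κ) : Prop where
  top : Order.IsSuccPrelimit g.s.top
  small : #{β // (g.c β).Nonempty} < κ
  closed : ∀ β δ, IsAcc (g.c β) δ → δ ∈ g.c β
  exists_max : ∀ β, (g.c β).Nonempty → ∃ m, IsGreatest (g.c β) m ∧ ∀ x : SRT b β,
    x.fst.1 = g.toRaw β → x.thread = genericSquare SR.toS g.s.top → inClub b β m x
  avoids : ∀ β, ∀ x ∈ g.c β, ∀ p : SR b β, p.1 = g.toRaw β →
    Stmt.neg (Stmt.mem x (SR.killedAt b β)) p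

/-- `IsGood` quantifies over all conditions with the prescribed raw part, so it makes sense before
any raw part is known to be valid. Validity is then obtained stage by stage, and one `g` serves all
stages at once. -/
theorem IsGood.toRaw_mem_valid {g : GroundCond κ} (hκ : κ.IsRegular) (hg : g.IsGood b)
    (α : WithTop (L κ)) : g.toRaw α ∈ (stage b α).valid := by
  induction α using WellFoundedLT.induction with
  | ind α ih =>
    rw [mem_stage_valid_iff]
    refine ⟨(mk_subtype_mono fun β hβ ↦ ?_).trans_lt hg.small, fun β hβ ↦ ?_⟩
    · obtain ⟨h, hne⟩ := hβ
      rw [coord_toRaw] at hne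
      by_contra hempty
      rw [not_nonempty_iff_eq_empty] at hempty
      exact hne (funext fun x ↦ by simp [hempty])
    · have hv : (g.toRaw α).restrict hβ.le ∈ (stage b β).valid := by
        rw [restrict_toRaw]
        exact ih β hβ
      refine ⟨hv, ?_⟩
      have key : Stmt.isClubShooting (P := SR b β) (SR.killedAt b β) (fun x ↦ {_q | x ∈ g.c β})
          ⟨(g.toRaw α).restrict hβ.le, hv⟩ := by
        refine ⟨⟨fun δ q _ hδ ↦ ?_, fun q _ ↦ ⟨q, le_rfl, ?_⟩⟩, fun x q hq hx ↦ ?_⟩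
        · refine Stmt.mem_const_iff.2 (hg.closed β δ ⟨?_, fun x hx ↦ ?_⟩)
          · obtain ⟨_, -, y, hy⟩ := hδ.1 q le_rfl
            exact ⟨y, Stmt.mem_const_iff.1 hy, y.2⟩
          · obtain ⟨_, -, y, hy⟩ := hδ.2 ⟨x, hx⟩ q le_rfl
            exact ⟨y, Stmt.mem_const_iff.1 hy, y.2.1, y.2.2⟩
        · have := noMaxOrder_K hκ
          have := nonempty_K hκ
          rcases (g.c β).eq_empty_or_nonempty with he | hne
          · exact ⟨Classical.arbitrary _, fun x r _ hr ↦ by simpa [he] using Stmt.mem_const_iff.1 hr⟩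
          · obtain ⟨m, hm, -⟩ := hg.exists_max β hne
            obtain ⟨δ, hδ⟩ := exists_gt m
            exact ⟨δ, fun x r _ hr ↦ (hm.2 (Stmt.mem_const_iff.1 hr)).trans_lt hδ⟩
        · exact hg.avoids β x (Stmt.mem_const_iff.1 hx.1) _ (restrict_toRaw g hβ.le) q hq hx.2
      rw [coord_toRaw]
      exact key

namespace IsGood

variable {g h : GroundCond κ}

/-- The condition in `𝕊 * ℝ_α` with the same coordinates below `α`. -/
noncomputable def toSR (hκ : κ.IsRegular) (hg : g.IsGood b) (α : WithTop (L κ)) : SR b α :=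
  ⟨g.toRaw α, hg.toRaw_mem_valid hκ α⟩

/-- The condition in `𝕊 * ℝ_α * 𝕋` with the same coordinates below `α`. -/
noncomputable def toSRT (hκ : κ.IsRegular) (hg : g.IsGood b) (α : WithTop (L κ)) : SRT b α :=
  ⟨hg.toSR hκ α, genericSquare SR.toS g.s.top, isThreadCond_genericSquare hg.top _⟩

end IsGood

/-! ### Lower bounds of coherent families of good conditions -/

/-- `g` and `h` are not in conflict at any coordinate. -/
def Coherent (g h : GroundCond κ) : Prop :=
  (SCond.LeTop g.s h.s ∨ SCond.LeTop h.s g.s) ∧ ∀ β, EndExt (g.c β) (h.c β) ∨ EndExt (h.c β) (g.c β)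

theorem coherent_of_le {f g h : GroundCond κ} (hg : f ≤ g) (hh : f ≤ h) : Coherent g h :=
  ⟨hg.1.total hh.1, fun β ↦ (hg.2 β).total (hh.2 β)⟩

/-- Every small set of pairwise coherent good conditions has a good lower bound. -/
theorem exists_isGood_forall_le (hκ : κ.IsRegular) {ι : Type u} (hι : #ι < κ)
    (g : ι → GroundCond κ) (hg : ∀ i, (g i).IsGood b) (hcoh : ∀ i j, Coherent (g i) (g j)) :
    ∃ h : GroundCond κ, h.IsGood b ∧ (∀ i, h ≤ g i) ∧
      ∀ β, (h.c β).Nonempty → ∃ i, ((g i).c β).Nonempty := by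
  obtain ⟨t, htop, ht⟩ := SCond.exists_leTop hκ hι (fun i ↦ (g i).s) (fun i ↦ (hg i).top)
    fun i j ↦ (hcoh i j).1
  let U (β : L κ) : Set (K κ) := ⋃ i, (g i).c β
  have hbdd : ∀ β, BddAbove (U β) := fun β ↦ by
    have : ∀ i, ∃ m, m ∈ upperBounds ((g i).c β) := fun i ↦ by
      rcases ((g i).c β).eq_empty_or_nonempty with he | hne
      · have := nonempty_K hκ
        exact ⟨Classical.arbitrary _, by simp [he]⟩
      · obtain ⟨m, hm, -⟩ := (hg i).exists_max β hne
        exact ⟨m, hm.2⟩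
    choose m hm using this
    obtain ⟨d, hd⟩ := bddAbove_of_mk_lt hκ (mk_range_le.trans_lt hι : #(range m) < κ)
    refine ⟨d, fun x hx ↦ ?_⟩
    obtain ⟨i, hi⟩ := mem_iUnion.1 hx
    exact (hm i hi).trans (hd (mem_range_self i))
  choose m hm using fun β ↦ exists_isLUB_of_bddAbove (hbdd β)
  have hUi : ∀ i β, EndExt (U β) ((g i).c β) := fun i β ↦ by
    refine ⟨subset_iUnion (fun i ↦ (g i).c β) i, fun y hy x hx hxy ↦ ?_⟩
    obtain ⟨j, hj⟩ := mem_iUnion.1 hx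
    rcases (hcoh i j).2 β with hE | hE
    · exact hE.1 hj
    · exact hE.2 y hy x hj hxy
  -- The supremum is added only where the union is nonempty. Otherwise `m β` is a meaningless
  -- default, and adding it would destroy the small support.
  let h : GroundCond κ := ⟨t, fun β ↦ {x | x ∈ U β ∨ x = m β ∧ (U β).Nonempty}⟩
  have hU : ∀ β, EndExt (h.c β) (U β) := fun β ↦ by
    refine ⟨fun x hx ↦ .inl hx, ?_⟩
    rintro y hy x (hx | ⟨rfl, -⟩) hxy
    · exact hx
    · rwa [hxy.antisymm ((hm β).1 hy)]
  have hle : ∀ i, h ≤ g i := fun i ↦ ⟨ht i, fun β ↦ (hU β).trans (hUi i β)⟩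
  have hne : ∀ β, (h.c β).Nonempty → (U β).Nonempty := by
    rintro β ⟨x, hx | hx⟩
    · exact ⟨x, hx⟩
    · exact hx.2
  have hne' : ∀ β, (h.c β).Nonempty → ∃ i, ((g i).c β).Nonempty := fun β hβ ↦ by
    obtain ⟨x, hx⟩ := hne β hβ
    obtain ⟨i, hi⟩ := mem_iUnion.1 hx
    exact ⟨i, x, hi⟩
  have hmax : ∀ β, (h.c β).Nonempty → IsGreatest (h.c β) (m β) := fun β hβ ↦ by
    refine ⟨.inr ⟨rfl, hne β hβ⟩, ?_⟩
    rintro x (hx | ⟨rfl, -⟩)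
    · exact (hm β).1 hx
    · exact le_rfl
  -- The maxima of the `c β` of the `g i` are cofinal in `m β` and are all forced into the club by
  -- `x`. Either one of them is `m β`, or `m β` is an accumulation point of the club.
  have hclub : ∀ β, (h.c β).Nonempty → ∀ x : SRT b β, x.fst.1 = h.toRaw β →
      x.thread = genericSquare SR.toS h.s.top → inClub b β (m β) x := by
    intro β hβ x hx hx'
    have hlim : ∀ y < m β, ∃ z, y < z ∧ z ≤ m β ∧ inClub b β z x := fun y hy ↦ by
      obtain ⟨z, hz, hyz⟩ := (lt_isLUB_iff (hm β)).1 hy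
      obtain ⟨i, hi⟩ := mem_iUnion.1 hz
      obtain ⟨w, hw, hwE⟩ := (hg i).exists_max β ⟨z, hi⟩
      refine ⟨w, hyz.trans_le (hw.2 hi), (hm β).1 (mem_iUnion.2 ⟨i, hw.1⟩), ?_⟩
      exact inClub_mono (srt_le_of_le hx hx' (y := (hg i).toSRT hκ β) rfl rfl (hle i))
        (hwE _ rfl rfl)
    by_cases hmem : inClub b β (m β) x
    · exact hmem
    obtain ⟨i, hi⟩ := hne' β hβ
    obtain ⟨w, hw, hwE⟩ := (hg i).exists_max β hi
    have hwx := inClub_mono (srt_le_of_le hx hx' (y := (hg i).toSRT hκ β) rfl rfl (hle i))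
        (hwE _ rfl rfl)
    have hwm : w ≤ m β := (hm β).1 (mem_iUnion.2 ⟨i, hw.1⟩)
    refine inClub_of_isAcc ⟨⟨w, hwx, hwm.lt_of_ne ?_⟩, fun y hy ↦ ?_⟩
    · rintro rfl
      exact hmem hwx
    · obtain ⟨z, hyz, hzm, hz⟩ := hlim y hy
      refine ⟨z, hz, hyz, hzm.lt_of_ne ?_⟩
      rintro rfl
      exact hmem hz
  refine ⟨h, ⟨htop, ?_, fun β δ hδ ↦ ?_, fun β hβ ↦ ⟨m β, hmax β hβ, hclub β hβ⟩, ?_⟩, hle, hne'⟩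
  · have hsub : {β | (h.c β).Nonempty} ⊆ ⋃ i, {β | ((g i).c β).Nonempty} := fun β hβ ↦
      mem_iUnion.2 (hne' β hβ)
    refine (mk_le_mk_of_subset hsub).trans_lt ?_
    exact (card_iUnion_lt_iff_forall_of_isRegular hκ hι).2 fun i ↦ (hg i).small
  · obtain ⟨y, hy, hyδ⟩ := hδ.1
    have hβ : (h.c β).Nonempty := ⟨y, hy⟩
    have hδm : δ ≤ m β := by
      by_contra hlt
      obtain ⟨z, hz, hmz, -⟩ := hδ.2 _ (not_le.1 hlt)
      exact absurd ((hmax β hβ).2 hz) (not_le.2 hmz)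
    rcases hδm.eq_or_lt with rfl | hδm
    · exact .inr ⟨rfl, hne β hβ⟩
    · obtain ⟨z, hz, hδz⟩ := (lt_isLUB_iff (hm β)).1 hδm
      obtain ⟨i, hi⟩ := mem_iUnion.1 hz
      refine ((hle i).2 β).1 ((hg i).closed β δ (hδ.mono fun x hx ↦ ?_))
      exact ((hle i).2 β).2 z hi x hx.1 ((le_of_lt hx.2).trans hδz.le)
  · rintro β x (hx | ⟨rfl, hx⟩) p hp
    · obtain ⟨i, hi⟩ := mem_iUnion.1 hx
      exact Stmt.neg_mono ((hg i).avoids β x hi ((hg i).toSR hκ β) rfl) (le_of_le hp rfl (hle i))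
    -- To see that the new maximum avoids the killed set, `p` is paired with the last entry of `h.s`
    -- as thread.
    · exact not_mem_killedAt_of_inClub hκ (x := ⟨p, _, isThreadCond_genericSquare htop p⟩)
        (hclub β (hx.mono (hU β).1) _ hp rfl)

end GroundCond

end SquareThread

namespace SquareThread

variable {κ : Cardinal.{u}} {b : Bookkeeping κ} {α : WithTop (L κ)}

/-! ## The dense `κ`-directed closed subset -/

/-- The conditions of `𝕊 * ℝ_α * 𝕋` which come from good ground model conditions. -/
def goodSet (b : Bookkeeping κ) (α : WithTop (L κ)) : Set (SRT b α) :=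
  {x | ∃ g : GroundCond κ, g.IsGood b ∧ (∀ β : L κ, ¬ (β : WithTop (L κ)) < α → g.c β = ∅) ∧
    x.fst.1 = g.toRaw α ∧ x.thread = genericSquare SR.toS g.s.top}

open GroundCond

/-- Compatibility is witnessed inside the good set. The data of two compatible conditions are
therefore initial segments of common ground model sets, hence coherent. -/
theorem isKDirectedClosed_goodSet (hκ : κ.IsRegular) (b : Bookkeeping κ) (α : WithTop (L κ)) :
    IsKDirectedClosed κ (goodSet b α) := by
  intro X hX hcompat
  choose g hg hsupp hraw hthread using fun x : goodSet b α ↦ x.2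
  obtain ⟨h, hh, hle, hne⟩ := exists_isGood_forall_le hκ hX (fun x : X ↦ g x) (fun x ↦ hg x)
    fun x y ↦ by
      obtain ⟨z, hzx, hzy⟩ := hcompat x x.2 y y.2
      exact coherent_of_le
        (le_of_srt_le (hraw z) (hthread z) (hraw x) (hthread x) (hsupp x) hzx)
        (le_of_srt_le (hraw z) (hthread z) (hraw y) (hthread y) (hsupp y) hzy)
  refine ⟨⟨hh.toSRT hκ α, h, hh, fun β hβ ↦ ?_, rfl, rfl⟩, fun x hx ↦
    srt_le_of_le (g := h) rfl rfl (hraw x) (hthread x) (hle ⟨x, hx⟩)⟩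
  by_contra hemp
  obtain ⟨i, hi⟩ := hne β (nonempty_iff_ne_empty.2 hemp)
  rw [hsupp i β hβ] at hi
  exact hi.ne_empty rfl

/-- Below a good condition, the coordinate `p(β)` can be strengthened to a ground model set. -/
theorem exists_isGood_endExtends_coord (hκ : κ.IsRegular) {β : L κ} (hD : IsDenseIn (goodSet b β))
    (p : SR b α) (hβ : (β : WithTop (L κ)) < α) {g : GroundCond κ} (hg : g.IsGood b)
    (hsupp : ∀ γ, (g.c γ).Nonempty → γ < β) (hle : hg.toSR hκ β ≤ p.restrict hβ.le) :
    ∃ h : GroundCond κ, h.IsGood b ∧ h ≤ g ∧ (∀ γ, (h.c γ).Nonempty → γ ≤ β) ∧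
      ∀ q : SR b β, q.1 = h.toRaw β →
        Stmt.endExtends (fun x ↦ {_q | x ∈ h.c β}) (p.coord β hβ) q := by
  have hp := p.isClubShooting_coord β hβ
  set N := p.coord β hβ with hN
  obtain ⟨r, hr, δ, hδ⟩ := hp.1.2 _ hle
  -- The name `N` is bounded by `δ`, so fewer than `κ` membership questions determine it, and stage
  -- `β` is distributive enough to answer all of them.
  obtain ⟨d, hd, hdr, hdec⟩ := exists_le_forall_mem hκ.aleph0_le hD
    (isKDirectedClosed_goodSet hκ b β) (mk_Iio_lt δ)
    (fun ξ x ↦ Stmt.mem (ξ : K κ) N x.fst ∨ Stmt.neg (Stmt.mem (ξ : K κ) N) x.fst)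
    (fun ξ x y hyx h ↦ h.imp (fun h ↦ Stmt.mem_mono h hyx.1) fun h ↦ Stmt.neg_mono h hyx.1)
    ((hg.toSRT hκ β).restrictFst r hr) fun ξ x _ ↦ by
      obtain ⟨q, hq, h⟩ := Stmt.exists_decide (Stmt.mem (ξ : K κ) N) x.fst
      exact ⟨x.restrictFst q hq, x.restrictFst_le hq, h⟩
  have hdp : d.fst ≤ p.restrict hβ.le := hdr.1.trans (hr.trans hle)
  obtain ⟨c, hc⟩ : ∃ c : Set (K κ), ∀ x, x ∈ c ↔ Stmt.mem x N d.fst := ⟨{x | _}, fun _ ↦ Iff.rfl⟩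
  have hcN : ∀ x, ∀ q ≤ d.fst, Stmt.mem x N q ↔ x ∈ c := fun x q hq ↦ by
    refine ⟨fun h ↦ (hc x).2 ?_, fun h ↦ Stmt.mem_mono ((hc x).1 h) hq⟩
    exact (hdec ⟨x, hδ x q (hq.trans hdr.1) h⟩).resolve_right fun h' ↦ h' q hq h
  have hcδ : ∀ x ∈ c, x < δ := fun x hx ↦ hδ x _ hdr.1 ((hc x).1 hx)
  -- Since `m ≥ δ` lies above all of `c`, the set `insert m c` end-extends `c` and has its maximum
  -- in the club.
  obtain ⟨y, hyd, m, hm, hmy⟩ := exists_inClub_ge δ d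
  obtain ⟨e, ⟨f, hf, hfsupp, hfraw, hfthread⟩, hey⟩ := hD y
  have hfβ : ∀ γ, (f.c γ).Nonempty → γ < β := fun γ hγ ↦ by
    by_contra hlt
    exact hγ.ne_empty (hfsupp γ fun h ↦ hlt (WithTop.coe_lt_coe.1 h))
  have hfg : f ≤ g := le_of_srt_le hfraw hfthread (y := hg.toSRT hκ β) rfl rfl
    (fun γ hγ ↦ not_nonempty_iff_eq_empty.1 fun h ↦ hγ (WithTop.coe_lt_coe.2 (hsupp γ h)))
    (hey.trans (hyd.trans (hdr.trans ((hg.toSRT hκ β).restrictFst_le hr))))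
  classical
  let h : GroundCond κ := ⟨f.s, fun γ ↦ if γ = β then insert m c else f.c γ⟩
  have hhβ : h.c β = insert m c := if_pos rfl
  have hhγ : ∀ γ, γ ≠ β → h.c γ = f.c γ := fun γ hγ ↦ if_neg hγ
  have hraw : ∀ γ ≤ β, h.toRaw γ = f.toRaw γ := fun γ hγ ↦ toRaw_congr rfl fun ξ hξ ↦
    hhγ ξ ((WithTop.coe_lt_coe.1 hξ).trans_le hγ).ne
  have hsupp' : ∀ γ, (h.c γ).Nonempty → γ ≤ β := fun γ hγ ↦ by
    by_cases hγβ : γ = β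
    · exact hγβ.le
    · rw [hhγ γ hγβ] at hγ
      exact (hfβ γ hγ).le
  have hed : ∀ q : SR b β, q.1 = h.toRaw β → q ≤ e.fst := fun q hq ↦
    le_of_le (g := f) (hq.trans (hraw β le_rfl)) hfraw le_rfl
  have hmax : IsGreatest (h.c β) m := by
    rw [hhβ]
    refine ⟨mem_insert _ _, ?_⟩
    rintro x (rfl | hx)
    · exact le_rfl
    · exact (hcδ x hx).le.trans hm
  refine ⟨h, ⟨hf.top, ?_, fun γ ξ hξ ↦ ?_, fun γ hγ ↦ ?_, fun γ x hx q hq ↦ ?_⟩,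
    ⟨hfg.1, fun γ ↦ ?_⟩, hsupp', fun q hq ↦ ?_⟩
  · have hsub : {γ | (h.c γ).Nonempty} ⊆ insert β {γ | (f.c γ).Nonempty} := fun γ hγ ↦ by
      by_cases hγβ : γ = β
      · exact .inl hγβ
      · exact .inr (by rwa [mem_ofPred, hhγ γ hγβ] at hγ)
    exact (mk_le_mk_of_subset hsub).trans_lt (mk_insert_le.trans_lt
      (add_lt_of_lt hκ.aleph0_le hf.small (one_lt_aleph0.trans_le hκ.aleph0_le)))
  · by_cases hγβ : γ = β
    · subst hγβ
      have hξm : ξ ≤ m := by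
        by_contra hlt
        obtain ⟨z, hz, hmz, -⟩ := hξ.2 _ (not_le.1 hlt)
        exact absurd (hmax.2 hz) (not_le.2 hmz)
      have hξc : IsAcc c ξ := hξ.mono fun x hx ↦ by
        rw [hhβ] at hx
        exact hx.1.resolve_left (ne_of_lt (lt_of_lt_of_le hx.2 hξm))
      rw [hhβ]
      refine .inr ((hc ξ).2 (hp.1.1 ξ _ hdp ⟨fun q hq ↦ ?_, fun x q hq ↦ ?_⟩))
      · obtain ⟨z, hz, hzξ⟩ := hξc.1
        exact ⟨q, le_rfl, ⟨z, hzξ⟩, (hcN z q hq).2 hz⟩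
      · obtain ⟨z, hz, hxz, hzξ⟩ := hξc.2 x x.2
        exact ⟨q, le_rfl, ⟨z, hxz, hzξ⟩, (hcN z q hq).2 hz⟩
    · rw [hhγ γ hγβ] at hξ ⊢
      exact hf.closed γ ξ hξ
  · by_cases hγβ : γ = β
    · subst hγβ
      exact ⟨m, hmax, fun x hx hx' ↦ inClub_mono
        (srt_le_of_le (g := f) (hx.trans (hraw γ le_rfl)) hx' hfraw hfthread le_rfl)
        (inClub_mono hey hmy)⟩
    · have hγ' := hsupp' γ hγ
      rw [hhγ γ hγβ] at hγ ⊢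
      rw [hraw γ hγ']
      exact hf.exists_max γ hγ
  · have hγ' := hsupp' γ ⟨x, hx⟩
    by_cases hγβ : γ = β
    · subst hγβ
      rw [hhβ] at hx
      have hqe := hed q hq
      rcases hx with rfl | hx
      · exact Stmt.neg_mono (not_mem_killedAt_of_inClub hκ (inClub_mono hey hmy)) hqe
      · have hqd : q ≤ d.fst := hqe.trans (hey.1.trans hyd.1)
        exact fun r hr hk ↦ hp.2 x r (hr.trans (hqd.trans hdp))
          ⟨(hcN x r (hr.trans hqd)).2 hx, hk⟩
    · rw [hhγ γ hγβ] at hx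
      exact hf.avoids γ x hx q (hq.trans (hraw γ hγ'))
  · by_cases hγβ : γ = β
    · subst hγβ
      rw [not_nonempty_iff_eq_empty.1 fun h ↦ lt_irrefl _ (hsupp γ h)]
      exact .empty _
    · rw [hhγ γ hγβ]
      exact hfg.2 γ
  · have hqd : q ≤ d.fst := (hed q hq).trans (hey.1.trans hyd.1)
    refine Stmt.endExtends_of_endExt (fun _ _ _ ↦ Stmt.mem_const_iff)
      (fun x r hr ↦ hcN x r (hr.trans hqd)) ?_
    rw [hhβ]
    refine ⟨subset_insert _ _, ?_⟩
    rintro z hz x (rfl | hx) hxz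
    · exact absurd (hm.trans hxz) (not_le.2 (hcδ z hz))
    · exact hx

/-- This makes an arbitrary thread condition `C δ` an initial segment of the last entry. If `δ` lies
beyond the top, the sequence is first lengthened to `δ`; uncountability of `κ` then provides a
further limit. -/
theorem SCond.exists_le_endExt (hκ : κ.IsRegular) (hκ' : ℵ₀ < κ) (s : SCond κ) (δ : K κ) :
    ∃ t ≤ s, Order.IsSuccPrelimit t.top ∧ δ ≤ t.top ∧ EndExt (t.C t.top) (t.C δ) := by
  wlog hδ : δ ≤ s.top generalizing s
  · obtain ⟨t, ht, rfl, -⟩ := s.exists_extend le_rfl (not_le.1 hδ)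
    obtain ⟨v, hv, h⟩ := this t le_rfl
    exact ⟨v, hv.trans ht, h⟩
  obtain ⟨τ, hτ, hl⟩ := exists_isSuccPrelimit_gt hκ hκ' s.top
  obtain ⟨t, ht, rfl, h⟩ := s.exists_extend hδ hτ
  exact ⟨t, ht, hl, hδ.trans ht.1, (ht.2 δ hδ).symm ▸ h hl⟩

theorem isDenseIn_goodSet (hκ : κ.IsRegular) (hκ' : ℵ₀ < κ) (b : Bookkeeping κ)
    (α : WithTop (L κ)) : IsDenseIn (goodSet b α) := by
  induction α using WellFoundedLT.induction with
  | ind α ih =>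
    intro x
    obtain ⟨p, hp, ⟨δ, hδl⟩, hxδ⟩ := x.forces x.fst le_rfl
    obtain ⟨s, hs, hl, hδ, hE⟩ := p.toS.exists_le_endExt hκ hκ' δ
    let g₀ : GroundCond κ := ⟨s, fun _ ↦ ∅⟩
    have hg₀ : g₀.IsGood b := ⟨hl, by
      have : IsEmpty {β // (g₀.c β).Nonempty} := ⟨fun β ↦ β.2.ne_empty rfl⟩
      rw [mk_eq_zero]
      exact hκ.pos, fun _ _ h ↦ h.1.elim fun _ h ↦ h.1, fun _ h ↦ (h.ne_empty rfl).elim,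
      fun _ _ h ↦ h.elim⟩
    let ι : Type u := {β : L κ // ∃ h : (β : WithTop (L κ)) < α, p.1.coord β h ≠ fun _ ↦ ∅}
    let good (i : ι) (g : GroundCond κ) : Prop := g.IsGood b ∧ g ≤ g₀ ∧
      (∀ γ, (g.c γ).Nonempty → γ ≤ i) ∧ ∀ q : SR b i.1, q.1 = g.toRaw i.1 →
        Stmt.endExtends (fun x ↦ {_q | x ∈ g.c i}) (p.coord i.1 i.2.1) q
    -- A bound for the coordinates already treated, with `g₀` included to cover `S = ∅`. It lies
    -- below `p ↾ γ` once `S` contains all supported coordinates below `γ`, because elsewhere `p`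
    -- has the empty name.
    have key : ∀ (S : Set ι) (f : ι → GroundCond κ), (∀ i ∈ S, good i (f i)) →
        (∀ i ∈ S, ∀ j ∈ S, j < i → f i ≤ f j) → ∃ h : GroundCond κ, h.IsGood b ∧ h ≤ g₀ ∧
        (∀ i ∈ S, h ≤ f i) ∧ (∀ γ, (h.c γ).Nonempty → ∃ i ∈ S, γ ≤ i.1) ∧
        ∀ (γ : WithTop (L κ)) (hγ : γ ≤ α), (∀ i : ι, (i.1 : WithTop (L κ)) < γ → i ∈ S) →
          ∀ q : SR b γ, q.1 = h.toRaw γ → q ≤ p.restrict hγ := by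
      intro S f hf hchain
      have hcard : #(Option S) < κ := by
        rw [mk_option]
        exact add_lt_of_lt hκ.aleph0_le ((mk_set_le S).trans_lt p.mk_support_lt)
          (one_lt_aleph0.trans_le hκ.aleph0_le)
      obtain ⟨h, hh, hle, hne⟩ := exists_isGood_forall_le hκ hcard
        (fun o : Option S ↦ o.elim g₀ fun i ↦ f i)
        (by rintro (_ | i); exacts [hg₀, (hf i i.2).1]) (by
          rintro (_ | i) (_ | j)
          · exact coherent_of_le le_rfl le_rfl
          · exact coherent_of_le (hf j j.2).2.1 le_rfl
          · exact coherent_of_le le_rfl (hf i i.2).2.1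
          · rcases lt_trichotomy (i : ι) j with hij | hij | hij
            · exact coherent_of_le (hchain j j.2 i i.2 hij) le_rfl
            · exact coherent_of_le (f := f i) le_rfl (by rw [hij]; exact le_rfl)
            · exact coherent_of_le le_rfl (hchain i i.2 j j.2 hij))
      refine ⟨h, hh, hle none, fun i hi ↦ hle (some ⟨i, hi⟩), fun γ hγ ↦ ?_, fun γ hγ hS q hq ↦ ?_⟩
      · obtain ⟨_ | i, hi⟩ := hne γ hγ
        · exact (hi.ne_empty rfl).elim
        · exact ⟨i, i.2, (hf i i.2).2.2.1 γ hi⟩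
      · refine SR.le_iff.2 ⟨?_, fun β hβ ↦ ?_⟩
        · rw [toS_eq hq]
          exact (hle none).1.1.trans (hs.trans_eq (Raw.base_restrict p.1 hγ).symm)
        · have hcoord : (p.restrict hγ).coord β hβ = p.coord β (hβ.trans_le hγ) := by
            unfold SR.coord SR.restrict
            simp
          rw [hcoord, coord_eq hq]
          by_cases hne : p.1.coord β (hβ.trans_le hγ) = fun _ ↦ ∅
          · refine Stmt.endExtends_empty _ fun ξ r _ hr ↦ ?_
            rw [SR.coord, hne] at hr
            exact Stmt.not_mem_empty hr
          · let i : ι := ⟨β, _, hne⟩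
            have hi : i ∈ S := hS i hβ
            have hqi : (q.restrict hβ.le).1 = h.toRaw β := by
              change q.1.restrict hβ.le = _
              rw [hq, restrict_toRaw]
            refine Stmt.endExtends_trans (fun _ _ _ ↦ le_trans)
              (q := (hf i hi).1.toSR hκ β) (le_of_le hqi rfl (hle (some ⟨i, hi⟩))) ?_
              ((hf i hi).2.2.2 _ rfl)
            exact Stmt.endExtends_of_endExt (fun _ _ _ ↦ Stmt.mem_const_iff)
              (fun _ _ _ ↦ Stmt.mem_const_iff) ((hle (some ⟨i, hi⟩)).2 β)
    have : Nonempty (GroundCond κ) := ⟨g₀⟩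
    -- Recursion along the support of `p`: the bound for the earlier coordinates lies below `p ↾ i`,
    -- so density at stage `i` can be used to treat `p(i)`.
    obtain ⟨f, hf, hchain⟩ := exists_descending (ι := ι) (fun g h ↦ g ≤ h) good
      fun i f hf hchain ↦ by
        obtain ⟨h, hh, hh₀, hle, hsupp, hp'⟩ := key (Iio i) f hf fun j hj k _ hkj ↦ hchain j hj k hkj
        obtain ⟨g, hg, hgh, hgsupp, hgE⟩ := exists_isGood_endExtends_coord hκ (ih i.1 i.2.1) p i.2.1
          hh (fun γ hγ ↦ let ⟨j, hj, hγj⟩ := hsupp γ hγ; hγj.trans_lt hj)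
          (hp' i.1 i.2.1.le (fun j hj ↦ WithTop.coe_lt_coe.1 hj) _ rfl)
        exact ⟨g, ⟨hg, hgh.trans hh₀, hgsupp, hgE⟩, fun j hj ↦ hgh.trans (hle j hj)⟩
    obtain ⟨h, hh, hh₀, -, hsupp, hp'⟩ := key univ f (fun i _ ↦ hf i) fun i _ j _ hji ↦ hchain i j hji
    have hhp : hh.toSR hκ α ≤ p := by
      have := hp' α le_rfl (fun _ _ ↦ mem_univ _) (hh.toSR hκ α) rfl
      rwa [show p.restrict le_rfl = p from Subtype.ext (Raw.restrict_self p.1)] at this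
    refine ⟨hh.toSRT hκ α, ⟨h, hh, fun β hβ ↦ ?_, rfl, rfl⟩, hhp.trans hp, ?_⟩
    · refine not_nonempty_iff_eq_empty.1 fun hne ↦ hβ ?_
      obtain ⟨i, -, hi⟩ := hsupp β hne
      exact (WithTop.coe_le_coe.2 hi).trans_lt i.2.1
    · have hle : ∀ q ≤ hh.toSR hκ α, SR.toS q ≤ h.s := fun q hq ↦
        (SR.toS_mono hq).trans_eq (toS_eq (g := h) rfl)
      refine Stmt.endExtends_of_endExt (C := h.s.C h.s.top) (D := s.C δ) (fun ξ q hq ↦ ?_)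
        (fun ξ q hq ↦ ?_) (hh₀.1.2.trans hE)
      · change Stmt.mem ξ (genericSquare SR.toS h.s.top) q ↔ _
        rw [mem_genericSquare_iff SR.toS_mono (hle q hq).1, (hle q hq).2 _ le_rfl]
      · have hqs : SR.toS q ≤ s := (hle q hq).trans hh₀.1.1
        rw [← hqs.2 δ hδ, ← mem_genericSquare_iff SR.toS_mono (hδ.trans hqs.1)]
        have := hxδ ξ
        exact ⟨this.1 q (hq.trans hhp), this.2 q (hq.trans hhp)⟩

end SquareThread

namespace SquareThread

/-! ## Dense subsets have the same regular open algebra -/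

section RegularOpen

variable {P : Type u} [Preorder P]

theorem mem_compl_lowerSet_iff {U : LowerSet P} {p : P} : p ∈ Uᶜ ↔ ∀ q ≤ p, q ∉ U := by
  rw [← LowerSet.Iic_le, le_compl_iff_disjoint_right, disjoint_iff_inf_le]
  exact ⟨fun h q hq hU ↦ h ⟨hq, hU⟩, fun h q hq ↦ h q hq.1 hq.2⟩

theorem isRegular_lowerSet_iff {U : LowerSet P} :
    Heyting.IsRegular U ↔ ∀ p, (∀ q ≤ p, ∃ r ≤ q, r ∈ U) → p ∈ U := by
  have h : ∀ p, p ∈ Uᶜᶜ ↔ ∀ q ≤ p, ∃ r ≤ q, r ∈ U := fun p ↦ by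
    simp only [mem_compl_lowerSet_iff, not_forall, not_not, exists_prop]
  refine ⟨fun hU p hp ↦ hU ▸ (h p).2 hp, fun hU ↦ SetLike.ext fun p ↦ (h p).trans ⟨hU p, ?_⟩⟩
  exact fun hp q hq ↦ ⟨q, le_rfl, U.lower hq hp⟩

theorem forcingEquiv_of_isDenseIn {D : Set P} (hD : IsDenseIn D) : ForcingEquiv P D := by
  let f (U : RO P) : RO D := ⟨⟨{d | (d : P) ∈ U.val}, fun _ _ h ha ↦ U.val.lower h ha⟩,
    isRegular_lowerSet_iff.2 fun d hd ↦ isRegular_lowerSet_iff.1 U.prop d fun q hq ↦ by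
      obtain ⟨e, he, heq⟩ := hD q
      obtain ⟨r, hr, hrU⟩ := hd ⟨e, he⟩ (heq.trans hq)
      exact ⟨r, le_trans (show (r : P) ≤ e from hr) heq, hrU⟩⟩
  let g (V : RO D) : RO P := ⟨⟨{p | ∀ d : D, (d : P) ≤ p → d ∈ V.val},
      fun _ _ h hp d hd ↦ hp d (hd.trans h)⟩,
    isRegular_lowerSet_iff.2 fun p hp d hd ↦ isRegular_lowerSet_iff.1 V.prop d fun e he ↦ by
      obtain ⟨r, hr, hrV⟩ := hp e (le_trans (show (e : P) ≤ d from he) hd)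
      obtain ⟨e', he', her⟩ := hD r
      exact ⟨⟨e', he'⟩, her.trans hr, hrV _ her⟩⟩
  refine ⟨{ toFun := f, invFun := g, left_inv := fun U ↦ ?_, right_inv := fun V ↦ ?_,
            map_rel_iff' := fun {U U'} ↦ ?_ }⟩
  · refine Heyting.Regular.coe_injective (SetLike.ext fun p ↦ ⟨fun hp ↦ ?_, fun hp d hd ↦ ?_⟩)
    · refine isRegular_lowerSet_iff.1 U.prop p fun q hq ↦ ?_
      obtain ⟨e, he, heq⟩ := hD q
      exact ⟨e, heq, hp ⟨e, he⟩ (heq.trans hq)⟩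
    · exact U.val.lower hd hp
  · refine Heyting.Regular.coe_injective (SetLike.ext fun d ↦ ⟨fun hd ↦ ?_, fun hd e he ↦ ?_⟩)
    · exact hd d le_rfl
    · exact V.val.lower he hd
  · refine ⟨fun h p hp ↦ ?_, fun h d hd ↦ h hd⟩
    refine isRegular_lowerSet_iff.1 U'.prop p fun q hq ↦ ?_
    obtain ⟨e, he, heq⟩ := hD q
    exact ⟨e, heq, h (a := ⟨e, he⟩) (U.val.lower (heq.trans hq) hp)⟩

end RegularOpen

/-! ## The chain condition -/

variable {κ : Cardinal.{u}}

/-- After embedding `Y` into `κ`, small sets are bounded by regularity. They lie in `κ` many power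
sets, each of size at most `2^{<κ} = κ`. -/
theorem mk_small_sets_le (hκ : κ.IsRegular) (hpow : (2 : Cardinal.{u}) ^< κ = κ) {Y : Type u}
    (hY : #Y ≤ κ) : #{X : Set Y // #X < κ} ≤ κ := by
  have hbdd : #{X : Set (K κ) | BddAbove X} ≤ κ := by
    have hsub : {X : Set (K κ) | BddAbove X} ⊆ ⋃ d : K κ, 𝒫 (Iic d) := fun X ⟨d, hd⟩ ↦
      mem_iUnion.2 ⟨d, fun _ hx ↦ hd hx⟩
    refine (mk_le_mk_of_subset hsub).trans ((mk_iUnion_le _).trans ?_)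
    rw [mk_ord_toType]
    refine (mul_le_mul_right (ciSup_le' fun d ↦ ?_) κ).trans (mul_eq_self hκ.aleph0_le).le
    rw [mk_powerset]
    exact (le_powerlt 2 (mk_Iic_lt hκ d)).trans_eq hpow
  rw [← mk_ord_toType κ] at hY
  obtain ⟨e⟩ := hY
  refine (mk_le_of_injective (f := fun X : {X : Set Y // #X < κ} ↦
    (⟨e '' X.1, bddAbove_of_mk_lt hκ (mk_image_le.trans_lt X.2)⟩ : {X : Set (K κ) | BddAbove X}))
    fun X X' h ↦ ?_).trans hbdd
  exact Subtype.ext (e.injective.image_injective (congrArg Subtype.val h))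

/-- A condition is determined by its top and the graph of `C`. The graph is small because entries
above the top are empty. -/
theorem SCond.mk_le (hκ : κ.IsRegular) (hpow : (2 : Cardinal.{u}) ^< κ = κ) : #(SCond κ) ≤ κ := by
  have hK : #(K κ) = κ := mk_ord_toType κ
  have hKK : #(K κ × K κ) ≤ κ := by
    rw [← mul_def, hK, mul_eq_self hκ.aleph0_le]
  have hlt : ∀ s : SCond κ, #{x : K κ × K κ | x.2 ∈ s.C x.1} < κ := fun s ↦ by
    have hsub : {x : K κ × K κ | x.2 ∈ s.C x.1} ⊆ Iic s.top ×ˢ Iic s.top := fun x hx ↦ by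
      have hx₁ : x.1 ≤ s.top := by
        by_contra h
        have hx' : x.2 ∈ s.C x.1 := hx
        rw [s.eq_empty _ (not_le.1 h)] at hx'
        exact hx'
      exact ⟨hx₁, (le_of_lt (s.subset _ hx₁ hx)).trans hx₁⟩
    refine (mk_le_mk_of_subset hsub).trans_lt ?_
    rw [mk_setProd]
    simpa using mul_lt_of_lt hκ.aleph0_le (mk_Iic_lt hκ s.top) (mk_Iic_lt hκ s.top)
  refine (mk_le_of_injective (f := fun s : SCond κ ↦
    ((s.top, ⟨_, hlt s⟩) : K κ × {X : Set (K κ × K κ) // #X < κ})) fun s t h ↦ ?_).trans ?_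
  · obtain ⟨htop, hC⟩ := Prod.mk.inj h
    have hC' : s.C = t.C := funext fun α ↦ Set.ext fun ξ ↦
      iff_of_eq (congrFun (congrArg Subtype.val hC) (α, ξ))
    cases s
    cases t
    congr
  · rw [← mul_def, hK]
    exact (mul_le_mul_right (mk_small_sets_le hκ hpow hKK) κ).trans
      (mul_eq_self hκ.aleph0_le).le

namespace GroundCond

variable {b : Bookkeeping κ}

theorem IsGood.mk_code_lt (hκ : κ.IsRegular) {g : GroundCond κ} (hg : g.IsGood b) (S : Set (L κ)) :
    #{x : S × K κ | x.2 ∈ g.c x.1} < κ := by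
  have hsub : {x : S × K κ | x.2 ∈ g.c x.1} ⊆
      ⋃ β : {β : S // (g.c β).Nonempty}, (fun ξ ↦ (β.1, ξ)) '' g.c β.1 := fun x hx ↦
    mem_iUnion.2 ⟨⟨x.1, x.2, hx⟩, x.2, hx, rfl⟩
  refine (mk_le_mk_of_subset hsub).trans_lt
    ((card_iUnion_lt_iff_forall_of_isRegular hκ ?_).2 fun β ↦ mk_image_le.trans_lt ?_)
  · refine (mk_le_of_injective (f := fun β : {β : S // (g.c β).Nonempty} ↦
      (⟨β.1.1, β.2⟩ : {β // (g.c β).Nonempty})) fun β β' h ↦ ?_).trans_lt hg.small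
    exact Subtype.ext (Subtype.ext (Subtype.mk.inj h))
  · obtain ⟨m, hm, -⟩ := hg.exists_max β.1 β.2
    exact mk_lt_of_bddAbove hκ ⟨m, hm.2⟩

variable {ι : Type u} {g : ι → GroundCond κ}

theorem exists_representatives (hκ : κ.IsRegular) (hpow : (2 : Cardinal.{u}) ^< κ = κ)
    (hg : ∀ i, (g i).IsGood b) {S : Set (L κ)} (hS : #S ≤ κ) :
    ∃ R : Set ι, #R ≤ κ ∧ ∀ i, ∃ j ∈ R, (g j).s = (g i).s ∧ ∀ β ∈ S, (g j).c β = (g i).c β := by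
  have hSK : #(S × K κ) ≤ κ := by
    rw [← mul_def, mk_ord_toType]
    exact (mul_le_mul_left hS κ).trans (mul_eq_self hκ.aleph0_le).le
  let code (i : ι) : SCond κ × {X : Set (S × K κ) // #X < κ} := ((g i).s, ⟨_, (hg i).mk_code_lt hκ S⟩)
  have hcode : #(SCond κ × {X : Set (S × K κ) // #X < κ}) ≤ κ := by
    rw [← mul_def]
    exact (mul_le_mul' (SCond.mk_le hκ hpow) (mk_small_sets_le hκ hpow hSK)).trans
      (mul_eq_self hκ.aleph0_le).le
  choose rep hrep using fun x : range code ↦ x.2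
  refine ⟨range rep, mk_range_le.trans ((mk_set_le _).trans hcode), fun i ↦
    ⟨rep ⟨code i, i, rfl⟩, mem_range_self _, ?_⟩⟩
  obtain ⟨hs, hX⟩ := Prod.mk.inj (hrep ⟨code i, i, rfl⟩)
  exact ⟨hs, fun β hβ ↦ Set.ext fun ξ ↦ iff_of_eq (congrFun (congrArg Subtype.val hX) (⟨β, hβ⟩, ξ))⟩

/-- The `κ⁺`-chain condition for good conditions. -/
theorem mk_le_of_pairwise_not_coherent (hκ : κ.IsRegular) (hpow : (2 : Cardinal.{u}) ^< κ = κ)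
    (hg : ∀ i, (g i).IsGood b) (hanti : ∀ i j, Coherent (g i) (g j) → i = j) : #ι ≤ κ := by
  have hκκ := mul_eq_self hκ.aleph0_le
  have hK : #(K κ) = κ := mk_ord_toType κ
  choose! R hR hrep using fun (S : Set (L κ)) (hS : #S ≤ κ) ↦ exists_representatives hκ hpow hg hS
  let supp (i : ι) : Set (L κ) := {β | ((g i).c β).Nonempty}
  -- A closing-off of length `κ` replaces the Δ-system lemma: `A i` represents all traces on `T i`,
  -- the union of the supports chosen earlier.
  let A : K κ → Set ι := wellFounded_lt.fix fun i F ↦ R (⋃ j : Iio i, ⋃ a : F j j.2, supp a)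
  let T (i : K κ) : Set (L κ) := ⋃ j : Iio i, ⋃ a : A j, supp a
  have hA : ∀ i, A i = R (T i) := fun i ↦ WellFounded.fix_eq _ _ i
  have hT : ∀ i, #(T i) ≤ κ := by
    intro i
    induction i using WellFoundedLT.induction with
    | ind i ih =>
      refine (mk_iUnion_le _).trans ((mul_le_mul' (mk_Iio_lt i).le (ciSup_le' fun j ↦ ?_)).trans
        hκκ.le)
      refine (mk_iUnion_le _).trans ((mul_le_mul' ?_ (ciSup_le' fun a : A j ↦ (hg a).small.le)).trans
        hκκ.le)
      rw [hA]
      exact hR _ (ih j j.2)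
  have hmono : ∀ i j, i ≤ j → T i ⊆ T j := fun i j hij β hβ ↦ by
    obtain ⟨k, hk⟩ := mem_iUnion.1 hβ
    exact mem_iUnion.2 ⟨⟨k, lt_of_lt_of_le k.2 hij⟩, hk⟩
  have hcover : ∀ a : ι, ∃ i, a ∈ A i := by
    intro a
    have := nonempty_K hκ
    choose! k hk using fun (β : L κ) (hβ : ∃ i, β ∈ T i) ↦ hβ
    -- The support of `a` is small, so its part inside the union of all `T j` is already contained
    -- in one `T i`.
    obtain ⟨i, hi⟩ := bddAbove_of_mk_lt hκ (mk_image_le.trans_lt (hg a).small : #(k '' supp a) < κ)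
    obtain ⟨a', ha', hs, hc⟩ := hrep (T i) (hT i) a
    rw [← hA] at ha'
    suffices a' = a from ⟨i, this ▸ ha'⟩
    -- The representative `a'` agrees with `a` on `T i`. Outside `T i` the supports are disjoint,
    -- since that of `a'` lies in a later `T j`. Hence the two are coherent, and so equal.
    refine hanti _ _ ⟨.inl (hs ▸ SCond.LeTop.refl _), fun β ↦ ?_⟩
    by_cases hβ : β ∈ T i
    · rw [hc β hβ]
      exact .inl (.refl _)
    · by_cases hβa : β ∈ supp a
      · by_cases hβa' : β ∈ supp a'
        · have := noMaxOrder_K hκ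
          obtain ⟨j, hj⟩ := exists_gt i
          have hβj : β ∈ T j := mem_iUnion.2 ⟨⟨i, hj⟩, mem_iUnion.2 ⟨⟨a', ha'⟩, hβa'⟩⟩
          exact (hβ (hmono _ _ (hi (mem_image_of_mem k hβa)) (hk β ⟨j, hβj⟩))).elim
        · rw [not_nonempty_iff_eq_empty.1 hβa']
          exact .inr (.empty _)
      · rw [not_nonempty_iff_eq_empty.1 hβa]
        exact .inl (.empty _)
  have huniv : (Set.univ : Set ι) ⊆ ⋃ i, A i := fun a _ ↦ mem_iUnion.2 (hcover a)
  rw [← mk_univ]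
  refine (mk_le_mk_of_subset huniv).trans ((mk_iUnion_le _).trans
    ((mul_le_mul' hK.le (ciSup_le' fun i ↦ ?_)).trans hκκ.le))
  rw [hA]
  exact hR _ (hT i)

end GroundCond

/-! ### Chain condition, distributivity and cardinals for `𝕊 * ℝ_α` -/

section

variable {b : Bookkeeping κ} {α : WithTop (L κ)}

open GroundCond

/-- The `κ⁺`-chain condition for `𝕊 * ℝ_α`. -/
theorem SR.mk_le_of_pairwise_incompatible (hκ : κ.IsRegular) (hκ' : ℵ₀ < κ)
    (hpow : (2 : Cardinal.{u}) ^< κ = κ) {ι : Type u} (p : ι → SR b α)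
    (hp : ∀ i j, Compatible (p i) (p j) → i = j) : #ι ≤ κ := by
  have hex : ∀ i, ∃ (g : GroundCond κ) (hg : g.IsGood b), hg.toSR hκ α ≤ p i := fun i ↦ by
    obtain ⟨x, hx, -⟩ := exists_withThread_fst_eq hκ SR.toS (p i)
    obtain ⟨y, ⟨g, hg, -, hy, -⟩, hyx⟩ := isDenseIn_goodSet hκ hκ' b α x
    exact ⟨g, hg, hx ▸ (le_of_le (q := y.fst) rfl hy le_rfl).trans hyx.1⟩
  choose g hg hgp using hex
  refine mk_le_of_pairwise_not_coherent hκ hpow hg fun i j hij ↦ hp i j ?_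
  obtain ⟨h, hh, hle, -⟩ := exists_isGood_forall_le (b := b) hκ
    (ι := ULift Bool) (mk_lt_aleph0.trans hκ') (fun i' ↦ bif i'.down then g i else g j)
    (by rintro ⟨_ | _⟩; exacts [hg j, hg i]) (by
      rintro ⟨_ | _⟩ ⟨_ | _⟩
      · exact coherent_of_le le_rfl le_rfl
      · exact ⟨hij.1.symm, fun β ↦ (hij.2 β).symm⟩
      · exact hij
      · exact coherent_of_le le_rfl le_rfl)
  exact ⟨hh.toSR hκ α, (le_of_le rfl rfl (hle ⟨true⟩)).trans (hgp i),
    (le_of_le rfl rfl (hle ⟨false⟩)).trans (hgp j)⟩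

/-- A function from an ordinal below `κ` into the ground model is decided by a dense set of
conditions. -/
theorem SR.exists_decide_function (hκ : κ.IsRegular) (hκ' : ℵ₀ < κ) {X Y : Type u} (hX : #X < κ)
    {F : Name (SR b α) (X × Y)} {q : SR b α} (hF : Stmt.isFunction F q) :
    ∃ r ≤ q, ∃ f : X → Y, ∀ x, Stmt.mem (x, f x) F r := by
  obtain ⟨x, rfl, -⟩ := exists_withThread_fst_eq hκ SR.toS q
  obtain ⟨d, -, hd, hdec⟩ := exists_le_forall_mem hκ.aleph0_le (isDenseIn_goodSet hκ hκ' b α)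
    (isKDirectedClosed_goodSet hκ b α) hX (fun i y ↦ ∃ v, Stmt.mem (i, v) F y.fst)
    (fun i y z hzy ⟨v, hv⟩ ↦ ⟨v, Stmt.mem_mono hv hzy.1⟩) x fun i y hy ↦ by
      obtain ⟨r, hr, v, hv⟩ := hF.1 i y.fst hy.1
      exact ⟨y.restrictFst r hr, y.restrictFst_le hr, v, hv⟩
  choose f hf using hdec
  exact ⟨d.fst, hd.1, f, hf⟩

/-- The sequence is decided completely, so it lies in the ground model and not merely in the
extension by `𝕊`. -/
theorem SR.isKDistributiveOver_toS (hκ : κ.IsRegular) (hκ' : ℵ₀ < κ) :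
    IsKDistributiveOver κ (SR.toS : SR b α → SCond κ) := by
  intro η hη θ F q hF
  obtain ⟨r, hr, f, hf⟩ := SR.exists_decide_function hκ hκ' (by rwa [mk_toType, ← lt_ord]) hF
  refine ⟨r, hr, fun x ↦ {_p | x.2 = f x.1}, fun x ↦ ⟨fun s hs hx ↦ ?_, fun s hs hx ↦ ?_⟩⟩
  · have : x.2 = f x.1 := hF.2 x.1 x.2 (f x.1) s (hs.trans hr) ⟨hx, Stmt.mem_mono (hf x.1) hs⟩
    exact Stmt.mem_const_iff (C := {x : η.ToType × θ.ToType | x.2 = f x.1}).2 this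
  · have : x.2 = f x.1 := Stmt.mem_const_iff (C := {x : η.ToType × θ.ToType | x.2 = f x.1}).1 hx
    have hx' : x = (x.1, f x.1) := Prod.ext rfl this
    rw [hx']
    exact Stmt.mem_mono (hf x.1) hs

/-- A function onto an ordinal in the extension yields one in the ground model. -/
theorem SR.exists_surjective (hκ : κ.IsRegular) (hκ' : ℵ₀ < κ)
    (hpow : (2 : Cardinal.{u}) ^< κ = κ) {X Y : Type u} [Nonempty Y]
    {F : Name (SR b α) (X × Y)} {q : SR b α} (hF : Stmt.isFunction F q) (hF' : Stmt.isOnto F q) :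
    ∃ f : X → Y, Function.Surjective f := by
  rcases lt_or_ge #X κ with hX | hX
  · obtain ⟨r, hr, f, hf⟩ := SR.exists_decide_function hκ hκ' hX hF
    refine ⟨f, fun y ↦ ?_⟩
    obtain ⟨s, hs, x, hx⟩ := hF' y r hr
    exact ⟨x, (hF.2 x y (f x) s (hs.trans hr) ⟨hx, Stmt.mem_mono (hf x) hs⟩).symm⟩
  -- `V x` is the set of possible values at `x`. Conditions forcing different values are
  -- incompatible, so the chain condition bounds its size by `κ`.
  · let V (x : X) : Set Y := {y | ∃ r ≤ q, Stmt.mem (x, y) F r}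
    have hV : ∀ x, #(V x) ≤ κ := fun x ↦ by
      choose r hr hrF using fun y : V x ↦ y.2
      refine SR.mk_le_of_pairwise_incompatible hκ hκ' hpow r fun y y' ⟨s, hsy, hsy'⟩ ↦ Subtype.ext ?_
      exact hF.2 x y y' s (hsy.trans (hr y))
        ⟨Stmt.mem_mono (hrF y) hsy, Stmt.mem_mono (hrF y') hsy'⟩
    have huniv : (Set.univ : Set Y) ⊆ ⋃ x, V x := fun y _ ↦ by
      obtain ⟨s, hs, x, hx⟩ := hF' y q le_rfl
      exact mem_iUnion.2 ⟨x, s, hs, hx⟩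
    have hY : #Y ≤ #X := by
      rw [← mk_univ]
      refine (mk_le_mk_of_subset huniv).trans ((mk_iUnion_le _).trans
        ((mul_le_mul' le_rfl (ciSup_le' hV)).trans ?_))
      rw [mul_eq_left (hκ.aleph0_le.trans hX) hX hκ.pos.ne']
    obtain ⟨e⟩ := hY
    exact ⟨Function.invFun e, Function.invFun_surjective e.injective⟩

theorem SR.preservesCardinalsOver_toS (hκ : κ.IsRegular) (hκ' : ℵ₀ < κ)
    (hpow : (2 : Cardinal.{u}) ^< κ = κ) :
    PreservesCardinalsOver (SR.toS : SR b α → SCond κ) := by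
  intro θ q hq η q' hq' hex
  obtain ⟨r, hr, F, hF, hF'⟩ := hex q' le_rfl
  have : Nonempty θ.ToType := Ordinal.nonempty_toType_iff.2 (ne_bot_of_gt η.2)
  obtain ⟨f, hf⟩ := SR.exists_surjective hκ hκ' hpow hF hF'
  -- The surjection `f` lies in the ground model, so its canonical name already contradicts in the
  -- extension by `𝕊` that `θ` is a cardinal.
  refine hq η r.toS (SR.toS_mono (hr.trans hq')) fun s _ ↦
    ⟨s, le_rfl, fun x ↦ {_p | x ∈ {x | x.2 = f x.1}}, ⟨fun x t _ ↦ ?_, fun x y y' t _ h ↦ ?_⟩,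
      fun y t _ ↦ ?_⟩
  · exact ⟨t, le_rfl, f x, Stmt.mem_const_iff.2 rfl⟩
  · have h₁ : y = f x := Stmt.mem_const_iff.1 h.1
    have h₂ : y' = f x := Stmt.mem_const_iff.1 h.2
    exact h₁.trans h₂.symm
  · obtain ⟨x, rfl⟩ := hf y
    exact ⟨t, le_rfl, x, Stmt.mem_const_iff.2 rfl⟩

end

end SquareThread

theorem mainTheorem4 (κ : Cardinal.{u}) (hκ : κ.IsRegular) (hκ_unc : ℵ₀ < κ)
    (hκ_pow : (2 : Cardinal.{u}) ^< κ = κ) (b : SquareThread.Bookkeeping κ) :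
    (∀ α : WithTop (SquareThread.L κ), ∃ D : Set (SquareThread.SRT b α),
      SquareThread.IsDenseIn D ∧ SquareThread.IsKClosed κ D ∧
        SquareThread.IsKDirectedClosed κ D) ∧
    (∃ (Q : Type u) (_ : Preorder Q), SquareThread.IsKDirectedClosed κ Q ∧
      SquareThread.ForcingEquiv (SquareThread.SRT b ⊤) Q) ∧
    SquareThread.IsKDistributiveOver κ
      (SquareThread.SR.toS : SquareThread.SR b ⊤ → SquareThread.SCond κ) ∧
    SquareThread.PreservesCardinalsOver
      (SquareThread.SR.toS : SquareThread.SR b ⊤ → SquareThread.SCond κ) := by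
  have hD := SquareThread.isDenseIn_goodSet hκ hκ_unc b
  have hcl := SquareThread.isKDirectedClosed_goodSet hκ b
  exact ⟨fun α ↦ ⟨_, hD α, (hcl α).isKClosed, hcl α⟩,
    ⟨SquareThread.goodSet b ⊤, inferInstance, hcl ⊤, SquareThread.forcingEquiv_of_isDenseIn (hD ⊤)⟩,
    SquareThread.SR.isKDistributiveOver_toS hκ hκ_unc,
    SquareThread.SR.preservesCardinalsOver_toS hκ hκ_unc hκ_pow⟩
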